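/- **Model.** Let $T\in\mathbb N$ be the horizon, $\Delta t>0$ the period length. The electricity price is $P_{t+1}=G(P_t,\varepsilon^P_t)$ with $G$ measurable and $G(p,\cdot)\ge 0$ for $p\ge0$. Given the production regime $u(t)=(u_1(t),u_2(t))\in\{0,1\}^2$ chosen at stage $t$, the allowance price satisfies $$X_{t+1}=X_t\exp\big(\kappa_X(f(u(t))-\log X_t)\Delta t+\sigma_X\varepsilon^X_t\big),\qquad f(u)=\log(\bar X+g_1u_1+g_2u_2),$$ where $\bar X+g_1u_1+g_2u_2>0$ for all $u$, $\varepsilon^X_t=\rho\varepsilon^P_t+\sqrt{1-\rho^2}\,\varepsilon^\perp_t$, $|\rho|\le1$, and all $\varepsilon^P_t,\varepsilon^\perp_t$ are independent standard Gaussian. Let $\pi_i(p,x)=\min(a_ip-b_ix-c_i,\,M)$ be the profit rate of player $i$, truncated from above at a level $M$, with $a_i,b_i\ge0$; let the switching costs satisfy $K_{i,j,j}=0$ and $K_{i,j,l}\le K_{i,j,k}+K_{i,k,l}$. Starting at date $s\in\{0,\dots,T\}$ from $P_s=p\ge0$, $X_s=x>0$ and inherited regime $\zeta\in\{0,1\}^2$,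 player $i$ maximizes $$\mathbb E\Big[\sum_{t=s}^{T-1}\big(\pi_i(P_t,X_t)\,u_i(t)\,\Delta t-K_{i,u_i(t-1),u_i(t)}\big)\Big],\qquad u(s-1)=\zeta .$$ **Correlated equilibria.** A communication device gives, at each stage and in each public state, a probability law $\gamma=(\gamma_{jk})_{j,k\in\{0,1\}}$ on joint moves ($0$ = keep the regime, $1$ = switch it; $j$ is the move of player 1, $k$ of player 2). At each stage a mediator draws a joint move with law $\gamma$, independently of everything else given the public state, and tells each player only her own component. The device is *Markov* if it is a measurable function of $(t,P_t,X_t,\zeta)$, $\zeta$ being the regime inherited from the previous stage. An admissible schedule of player $i$ is a $\{0,1\}$-valued process $u_i$ such that $u_i(t)$ is determined by the prices up to $t$, the actions of both players before $t$, her own signals up to and including $t$ (which she receives also after deviating), and private independent randomization. The device is a *correlated equilibrium* of the switching game if, from every initial $(s,p,x,\zeta)$ as above, no player can increase her expected profit by replacing obedience by an admissible schedule while the other player obeys. A *Markovian correlated equilibrium point* (CEP) is a Markov device with this property. A *correlation law* is a map $\Gamma$ that assigns to $(t,p,x,\zeta)$ and to every $2\times2$ bimatrix game $H$ a correlated equilibrium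 $\Gamma(t,p,x,\zeta,H)$ of $H$, measurably in $(p,x,H)$. **Theorem.** Fix a correlation law $\Gamma$. Define a Markov device $\gamma$ by backward induction in $t=T-1,\dots,0$: $\gamma(t,p,x,\zeta)=\Gamma(t,p,x,\zeta,H_t(p,x,\zeta))$, where in $H_t(p,x,\zeta)$ a joint move leading from $\zeta$ to the regime $\xi$ pays player $i$ the amount $Y_i(\xi)-K_{i,\zeta_i,\xi_i}$, with $Y_i$ the one-step continuation values displayed below (computed from the values already found for date $t+1$, which are $0$ at date $T$). Then: 1. $\gamma$ is a Markovian CEP of the switching game. 2. Its game values $V_i(t,p,x,\zeta)$, i.e. the expected profits when both players obey $\gamma$, satisfy $V_i(T,\cdot)=0$ and, for all $t<T$, $p\ge0$, $x>0$, $\zeta\in\{0,1\}^2$, with $\gamma_{jk}=\gamma_{jk}(t,p,x,\zeta)$, $$\begin{aligned}V_1(t,p,x,\zeta)={}&\gamma_{00}Y_1(\zeta_1,\zeta_2)+\gamma_{01}Y_1(\zeta_1,1-\zeta_2)+\gamma_{10}\big(Y_1(1-\zeta_1,\zeta_2)-K_{1,\zeta_1,1-\zeta_1}\big)\\&+\gamma_{11}\big(Y_1(1-\zeta_1,1-\zeta_2)-K_{1,\zeta_1,1-\zeta_1}\big),\\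 V_2(t,p,x,\zeta)={}&\gamma_{00}Y_2(\zeta_1,\zeta_2)+\gamma_{01}\big(Y_2(\zeta_1,1-\zeta_2)-K_{2,\zeta_2,1-\zeta_2}\big)+\gamma_{10}Y_2(1-\zeta_1,\zeta_2)\\&+\gamma_{11}\big(Y_2(1-\zeta_1,1-\zeta_2)-K_{2,\zeta_2,1-\zeta_2}\big),\end{aligned}$$ where $$Y_i(\xi)=\mathbb E\big[V_i(t+1,P_{t+1},X_{t+1},\xi)\,\big|\,P_t=p,\ X_t=x,\ u(t)=\xi\big]+\pi_i(p,x)\,\xi_i\,\Delta t,$$ all expectations being those of integrable variables, and $\gamma(t,p,x,\zeta)=\Gamma(t,p,x,\zeta,H)$ for the game $H$ with these payoffs $Y_i(\xi)-K_{i,\zeta_i,\xi_i}$. 3. The equilibrium controls can be taken as $u_i^{T,T}$. Here, for $n,m\ge0$, the values $\hat J^{n,m}_i$ of the game in which the players may still switch at most $n$ and $m$ times, each at most once per stage, are defined by $\hat J^{n,m}_i(T,\cdot)=0$ and backward recursion through stopping games for the next switch: in regime $\zeta$ at date $t$, if nobody switches the same game continues; otherwise it is replaced, in the new regime, by the game with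 the budgets diminished by the switches made and the costs are charged. The law of the stage-$t$ joint move is selected by $\Gamma$ if $n,m\ge1$; if only one player can still switch she maximizes (keeping the regime in case of a tie); if $n=m=0$ the regime is kept. The device $\gamma^{T,T}$ uses at stage $t$ the law of the $(T-k_1(t),T-k_2(t))$-game, $k_i(t)$ being the number of switches player $i$ has made so far, and $u^{T,T}_i$ are the controls of the players when they obey it. Then obeying $\gamma^{T,T}$ is a correlated equilibrium of the switching game, the controls $u_i^{T,T}$ coincide path by path with those of the players obeying $\gamma$, and the expected profits under $u^{T,T}$ as well as $\hat J^{T,T}_i$ are equal to $V_i$. -/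

import Mathlib

open MeasureTheory ProbabilityTheory

noncomputable section

namespace SwitchingGame

/-! ### One-shot two-player games with two actions -/

/-- A pair of binary choices, one for each of the two players `0` and `1`.  It is used both for
production regimes (`true` = on, `false` = off) and for joint moves (`true` = switch regime,
`false` = keep regime). -/
abbrev Profile := Fin 2 → Bool

/-- A `2 × 2` bimatrix game: `H i a` is the payoff of player `i` under the joint move `a`. -/
abbrev Game := Fin 2 → Profile → ℝ

/-- `q` is a correlated equilibrium of `H`: a probability distribution on joint moves such that,
for each player `i` and each recommendation `j`, no other move `j'` does better against the
conditional distribution of the opponent's move (inequalities multiplied by the probability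
of the recommendation). -/
def IsOneShotCE (H : Game) (q : Profile → ℝ) : Prop :=
  q ∈ stdSimplex ℝ Profile ∧
    ∀ (i : Fin 2) (j j' : Bool),
      ∑ a : Profile with a i = j, q a * H i (Function.update a i j') ≤
        ∑ a : Profile with a i = j, q a * H i a

/-- A correlation law: a measurable selector of correlated equilibria of `2 × 2` games.  The
selection may depend on the date `t` and on the current state of the world
(prices `p`, `x` and regime `ζ`). -/
structure CorrelationLaw where
  sel : ℕ → ℝ → ℝ → Profile → Game → Profile → ℝ
  measurable_sel : ∀ (t : ℕ) (ζ : Profile),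
    Measurable fun y : ℝ × ℝ × Game => sel t y.1 y.2.1 ζ y.2.2
  isCE_sel : ∀ (t : ℕ) (p x : ℝ) (ζ : Profile) (H : Game), IsOneShotCE H (sel t p x ζ H)

/-! ### The model -/

/-- The data of the CO2 duopoly. -/
structure Model where
  /-- horizon -/
  T : ℕ
  /-- length of a period -/
  dt : ℝ
  dt_pos : 0 < dt
  /-- electricity price dynamics `P (t+1) = G (P t) ε` -/
  G : ℝ → ℝ → ℝ
  measurable_G : Measurable (Function.uncurry G)
  G_nonneg : ∀ p z, 0 ≤ p → 0 ≤ G p z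
  /-- mean-reversion speed and volatility of the allowance price -/
  κX : ℝ
  σX : ℝ
  /-- correlation of the Gaussian innovations of the two prices -/
  ρ : ℝ
  abs_ρ_le : |ρ| ≤ 1
  /-- base level of the allowance price, and price impact of each producer -/
  Xbar : ℝ
  g : Fin 2 → ℝ
  level_pos : ∀ u : Profile, 0 < Xbar + ∑ i, (if u i then g i else 0)
  /-- production quantity, allowances needed, and fixed costs of each producer -/
  a : Fin 2 → ℝ
  b : Fin 2 → ℝ
  c : Fin 2 → ℝ
  a_nonneg : ∀ i, 0 ≤ a i
  b_nonneg : ∀ i, 0 ≤ b i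
  /-- level at which one-period profit rates are truncated from above -/
  cap : ℝ
  /-- switching costs -/
  K : Fin 2 → Bool → Bool → ℝ
  K_self : ∀ i j, K i j j = 0
  K_triangle : ∀ i j k l, K i j l ≤ K i j k + K i k l

/-- Noise of one stage: two independent standard Gaussian variables driving the prices, a uniform
variable of the mediator, and a uniform variable for the private randomization of a deviating
player. -/
abbrev Noise := ℝ × ℝ × unitInterval × unitInterval

def noiseLaw : Measure Noise :=
  (gaussianReal 0 1).prod
    ((gaussianReal 0 1).prod
      ((volume : Measure unitInterval).prod (volume : Measure unitInterval)))

instance : IsProbabilityMeasure noiseLaw := by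
  unfold noiseLaw; infer_instance

/-- The sample space: a sequence of stage noises. -/
abbrev Sample := ℕ → Noise

/-- The noises of different stages are independent. -/
def sampleLaw : Measure Sample := Measure.infinitePi fun _ : ℕ => noiseLaw

/-- The regime resulting from `ζ` under the joint move `a`. -/
def applyMove (ζ a : Profile) : Profile := fun i => xor (ζ i) (a i)

/-- Public state at the beginning of a stage: the prices `P` and `X`, the production regime
inherited from the previous stage, and the number of switches made so far by each player. -/
abbrev State := ℝ × ℝ × Profile × (Fin 2 → ℕ)

/-- A (stepwise) communication device: the law of the recommended joint move
(keep / switch for each player), given the date and the public state. -/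
abbrev Device := ℕ → State → Profile → ℝ

/-- A Markov communication device depends on date, prices and current regime only. -/
abbrev MarkovDevice := ℕ → ℝ → ℝ → Profile → Profile → ℝ

def MarkovDevice.toDevice (γ : MarkovDevice) : Device :=
  fun t S => γ t S.1 S.2.1 S.2.2.1

/-- The mediator draws a joint move with law `q` from a uniform variable `e`. -/
def draw (q : Profile → ℝ) (e : ℝ) : Profile :=
  if e ≤ q ![false, false] then ![false, false]
  else if e ≤ q ![false, false] + q ![false, true] then ![false, true]
  else if e ≤ q ![false, false] + q ![false, true] + q ![true, false] then ![true, false]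
  else ![true, true]

/-- The recommended joint move at date `t` in state `S`; player `i` is only told component `i`. -/
def signal (δ : Device) (t : ℕ) (S : State) (w : Noise) : Profile :=
  draw (δ t S) (w.2.2.1 : ℝ)

namespace Model

/-- Profit rate of player `i` when producing, truncated from above. -/
def profit (M : Model) (i : Fin 2) (p x : ℝ) : ℝ :=
  min (M.a i * p - M.b i * x - M.c i) M.cap

/-- Logarithmic mean-reversion level of the allowance price under the regime `u`. -/
def logLevel (M : Model) (u : Profile) : ℝ :=
  Real.log (M.Xbar + ∑ i, (if u i then M.g i else 0))

def nextP (M : Model) (p : ℝ) (w : Noise) : ℝ := M.G p w.1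

def nextX (M : Model) (x : ℝ) (u : Profile) (w : Noise) : ℝ :=
  x * Real.exp (M.κX * (M.logLevel u - Real.log x) * M.dt
    + M.σX * (M.ρ * w.1 + Real.sqrt (1 - M.ρ ^ 2) * w.2.1))

/-- The next public state when the regime `u` is chosen in state `S`. -/
def next (M : Model) (S : State) (u : Profile) (w : Noise) : State :=
  (M.nextP S.1 w, M.nextX S.2.1 u w, u,
    fun i => S.2.2.2 i + if u i = S.2.2.1 i then 0 else 1)

/-- Net profit of player `i` over one stage begun in state `S` when the regime `u` is chosen. -/
def reward (M : Model) (i : Fin 2) (S : State) (u : Profile) : ℝ :=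
  (if u i then M.profit i S.1 S.2.1 * M.dt else 0) - M.K i (S.2.2.1 i) (u i)

/-! ### Plays of the switching game -/

/-- How the regime at date `t` arises from the state and the recommended joint move. -/
abbrev Rule := ℕ → Sample → State → Profile → Profile

/-- Both players follow the recommendations. -/
def obey : Rule := fun _ _ S m => applyMove S.2.2.1 m

/-- Player `i` uses the production schedule `u`; the opponent follows the recommendations. -/
def deviate (i : Fin 2) (u : ℕ → Sample → Bool) : Rule :=
  fun t ω S m => Function.update (applyMove S.2.2.1 m) i (u t ω)

/-- The public state at the beginning of stage `s + k`, in the play begun at date `s` in `S₀`. -/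
def path (M : Model) (δ : Device) (R : Rule) (s : ℕ) (S₀ : State) (ω : Sample) : ℕ → State
  | 0 => S₀
  | k + 1 =>
    M.next (path M δ R s S₀ ω k)
      (R (s + k) ω (path M δ R s S₀ ω k)
        (signal δ (s + k) (path M δ R s S₀ ω k) (ω (s + k))))
      (ω (s + k))

/-- The joint move recommended at stage `s + k`. -/
def recommendation (M : Model) (δ : Device) (R : Rule) (s : ℕ) (S₀ : State) (ω : Sample)
    (k : ℕ) : Profile :=
  signal δ (s + k) (M.path δ R s S₀ ω k) (ω (s + k))

/-- The regime chosen at stage `s + k`, that is, the pair of controls at that date. -/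
def control (M : Model) (δ : Device) (R : Rule) (s : ℕ) (S₀ : State) (ω : Sample)
    (k : ℕ) : Profile :=
  R (s + k) ω (M.path δ R s S₀ ω k) (M.recommendation δ R s S₀ ω k)

/-- Cumulative net profit of player `i` over the stages `s, …, T - 1`. -/
def payoff (M : Model) (i : Fin 2) (δ : Device) (R : Rule) (s : ℕ) (S₀ : State)
    (ω : Sample) : ℝ :=
  ∑ k ∈ Finset.range (M.T - s),
    M.reward i (M.path δ R s S₀ ω k) (M.control δ R s S₀ ω k)

/-- Initial state, with no switch made yet. -/
def start (p x : ℝ) (ζ : Profile) : State := (p, x, ζ, fun _ => 0)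

/-- Expected cumulative net profit of player `i` from date `s` on. -/
def expectedProfit (M : Model) (i : Fin 2) (δ : Device) (R : Rule) (s : ℕ) (p x : ℝ)
    (ζ : Profile) : ℝ :=
  ∫ ω, M.payoff i δ R s (start p x ζ) ω ∂sampleLaw

/-- `u` is an admissible (randomized) schedule of player `i` in the play begun at date `s` in
`S₀`: its value at stage `s + k` is determined by the public states up to then (prices and past
actions), the private signals received up to and including stage `s + k` (received also after
deviations), and private randomization independent of the rest. -/
def IsAdmissible (M : Model) (δ : Device) (i : Fin 2) (s : ℕ) (S₀ : State)
    (u : ℕ → Sample → Bool) : Prop :=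
  ∀ k < M.T - s,
    Measurable[⨆ j : Fin (k + 1), MeasurableSpace.comap
      (fun ω : Sample =>
        (M.path δ (deviate i u) s S₀ ω j, M.recommendation δ (deviate i u) s S₀ ω j i,
          (ω (s + j)).2.2.2))
      inferInstance] (u (s + k))

/-- Following the device `δ` is a correlated equilibrium of the switching game, from every
date and every initial condition: payoffs are integrable and no admissible unilateral deviation
is profitable. -/
def IsCorrelatedEquilibrium (M : Model) (δ : Device) : Prop :=
  ∀ (s : ℕ) (p x : ℝ) (ζ : Profile), s ≤ M.T → 0 ≤ p → 0 < x → ∀ i : Fin 2,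
    Integrable (M.payoff i δ obey s (start p x ζ)) sampleLaw ∧
    ∀ u : ℕ → Sample → Bool, M.IsAdmissible δ i s (start p x ζ) u →
      Integrable (M.payoff i δ (deviate i u) s (start p x ζ)) sampleLaw ∧
      M.expectedProfit i δ (deviate i u) s p x ζ ≤ M.expectedProfit i δ obey s p x ζ

/-- A Markovian correlated equilibrium point of the switching game. -/
def IsMarkovCEP (M : Model) (γ : MarkovDevice) : Prop :=
  (∀ (t : ℕ) (ζ : Profile), Measurable fun y : ℝ × ℝ => γ t y.1 y.2 ζ) ∧
  (∀ (t : ℕ) (p x : ℝ) (ζ : Profile), γ t p x ζ ∈ stdSimplex ℝ Profile) ∧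
  M.IsCorrelatedEquilibrium γ.toDevice

/-- Game value of player `i` under the Markov device `γ`. -/
def gameValue (M : Model) (γ : MarkovDevice) (i : Fin 2) (t : ℕ) (p x : ℝ) (ζ : Profile) : ℝ :=
  M.expectedProfit i γ.toDevice obey t p x ζ

/-! ### Stage games and the device generated by a correlation law -/

/-- One-step continuation value of player `i` from prices `p`, `x` when the regime `ξ` is in force
during the stage and `W` gives the values at the next date. -/
def continuation (M : Model) (W : Fin 2 → ℝ → ℝ → Profile → ℝ) (i : Fin 2) (p x : ℝ)
    (ξ : Profile) : ℝ :=
  (∫ w, W i (M.nextP p w) (M.nextX x ξ w) ξ ∂noiseLaw)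
    + (if ξ i then M.profit i p x * M.dt else 0)

/-- The stage game in regime `ζ`, where the next-date values `W a` may depend on the joint
move `a`. -/
def stageGame (M : Model) (W : Profile → Fin 2 → ℝ → ℝ → Profile → ℝ) (p x : ℝ)
    (ζ : Profile) : Game :=
  fun i a => M.continuation (W a) i p x (applyMove ζ a) - M.K i (ζ i) (applyMove ζ a i)

/-- Backward induction with the correlation law: values with `k` stages to go. -/
def backward (M : Model) (Γ : CorrelationLaw) : ℕ → Fin 2 → ℝ → ℝ → Profile → ℝ
  | 0 => fun _ _ _ _ => 0
  | k + 1 => fun i p x ζ =>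
      ∑ a, Γ.sel (M.T - (k + 1)) p x ζ (M.stageGame (fun _ => backward M Γ k) p x ζ) a
        * M.stageGame (fun _ => backward M Γ k) p x ζ i a

/-- The Markov device generated by `Γ`: at each date, `Γ` is applied to the stage game whose
continuation values have been found by proceeding back in time. -/
def inducedDevice (M : Model) (Γ : CorrelationLaw) : MarkovDevice :=
  fun t p x ζ => Γ.sel t p x ζ (M.stageGame (fun _ => M.backward Γ (M.T - (t + 1))) p x ζ)

/-! ### Games with a bounded number of switches -/

/-- The joint move "nobody switches". -/
def stay : Profile := fun _ => false

/-- The joint move "only player `i` switches". -/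
def switchOnly (i : Fin 2) : Profile := Function.update stay i true

/-- An optimal choice of player `i` when the opponent cannot switch any more (as a point mass). -/
def soloWeights (i : Fin 2) (H : Game) : Profile → ℝ :=
  Pi.single (if H i stay < H i (switchOnly i) then switchOnly i else stay) 1

/-- The law of the joint move when the players have `n 0` and `n 1` switches left: the correlation
law decides if both can switch, a player who alone can switch optimizes, and otherwise the regime
is kept. -/
def budgetWeights (Γ : CorrelationLaw) (n : Fin 2 → ℕ) (t : ℕ) (p x : ℝ) (ζ : Profile)
    (H : Game) : Profile → ℝ :=
  if n 0 = 0 then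
    (if n 1 = 0 then Pi.single stay 1 else soloWeights 1 H)
  else
    (if n 1 = 0 then soloWeights 0 H else Γ.sel t p x ζ H)

/-- Switches left after the joint move `a`. -/
def spend (n : Fin 2 → ℕ) (a : Profile) : Fin 2 → ℕ := fun i => n i - if a i then 1 else 0

/-- Values of the game in which at most `n i` further switches (at most one per stage) are allowed
to player `i`, with `k` stages to go.  In regime `ζ` this is the stopping game for the next
switch: joint move `stay` continues the same game, and a move in which somebody switches leads to
the game with fewer switches left, in the new regime. -/
def budgetValue (M : Model) (Γ : CorrelationLaw) :
    ℕ → (Fin 2 → ℕ) → Fin 2 → ℝ → ℝ → Profile → ℝ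
  | 0 => fun _ _ _ _ _ => 0
  | k + 1 => fun n i p x ζ =>
      ∑ a, budgetWeights Γ n (M.T - (k + 1)) p x ζ
          (M.stageGame (fun a' => budgetValue M Γ k (spend n a')) p x ζ) a
        * M.stageGame (fun a' => budgetValue M Γ k (spend n a')) p x ζ i a

/-- The device for the game with at most `n 0`, `n 1` switches, which remembers the
numbers of switches already made.  The controls of the players obeying it descend through
the stopping games for the successive switches. -/
def budgetDevice (M : Model) (Γ : CorrelationLaw) (n : Fin 2 → ℕ) : Device :=
  fun t S =>
    budgetWeights Γ (fun i => n i - S.2.2.2 i) t S.1 S.2.1 S.2.2.1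
      (M.stageGame
        (fun a => M.budgetValue Γ (M.T - (t + 1)) (spend (fun i => n i - S.2.2.2 i) a))
        S.1 S.2.1 S.2.2.1)

end Model

end SwitchingGame

end

open MeasureTheory ProbabilityTheory

noncomputable section

namespace SwitchingGame

/-! ### Noise -/

/-! The proof is dynamic programming with a verification argument. Let `backward` be the values
produced by selecting a correlated equilibrium of the stage game at each date. Along any play,
consider the profits already collected plus the `backward` value of the current state
(`runningValue`). Its integral at the start is the `backward` value, and at the horizon it is the
expected payoff. If both players obey, each stage preserves the integral, because the mediator's
draw has the selected law and the stage value is defined as its average (`integral_stage_obey`). If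
one player deviates, no stage increases it: conditionally on the past and on her private
randomization, her choice is a function of her own signal alone, so the correlated equilibrium
inequalities of the stage game, one per recommendation, bound the stage
(`integral_stage_deviate_le`). Summing over stages gives equilibrium and the game values at once
(`integral_payoff_le`, `integral_payoff_eq`).

Conditional expectations are replaced by resampling: overwriting the noise of one stage by an
independent copy preserves the law of the sample (`measurePreserving_update`). This helps only if
everything decided earlier ignores that noise, hence `IsNonanticipating`; for an admissible
deviation it follows because a schedule measurable with respect to the player's information is a
function of it.

Integrability rests on `HasLogGrowth`. The truncation of the profit removes all growth in `p`, and
the remaining growth in `x` is exponential in `|log x|`. Since the log price is an autoregression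
with Gaussian noise, all these exponential moments are finite, and the growth class is stable under
the one-step expectation.

Finally, a budget of `T` switches never binds when each player switches at most once per stage.
Hence the budget device equals the Markov device in every state reachable from a start, and
everything transfers path by path. -/

instance : IsProbabilityMeasure sampleLaw := by
  unfold sampleLaw; infer_instance

/-- Resampling the noise of one stage does not change the law of the sample. -/
theorem measurePreserving_update (n : ℕ) :
    MeasurePreserving (fun z : Sample × Noise => Function.update z.1 n z.2)
      (sampleLaw.prod noiseLaw) sampleLaw := by
  have hm : Measurable (fun z : Sample × Noise => Function.update z.1 n z.2) := by
    refine measurable_pi_lambda _ fun j => ?_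
    by_cases h : j = n
    · subst h; simpa using measurable_snd
    · simp only [Function.update_of_ne h]
      exact (measurable_pi_apply j).comp measurable_fst
  refine ⟨hm, ?_⟩
  refine Measure.eq_infinitePi (μ := fun _ : ℕ => noiseLaw) fun s t ht => ?_
  rw [Measure.map_apply hm (MeasurableSet.pi s.countable_toSet fun i _ => ht i)]
  -- The infinite product is characterized by finite boxes. The preimage of a box is again a box,
  -- with the constraint on coordinate `n`, if there is one, moved to the fresh noise.
  have hpre : (fun z : Sample × Noise => Function.update z.1 n z.2) ⁻¹' (Set.pi s t) =
      (Set.pi (s.erase n : Finset ℕ) t) ×ˢ (if n ∈ s then t n else Set.univ) := by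
    ext ⟨ω, w⟩
    simp only [Set.mem_preimage, Set.mem_pi, Set.mem_prod, Finset.mem_coe, Finset.mem_erase]
    constructor
    · intro h
      refine ⟨fun i hi => by simpa [Function.update_of_ne hi.1] using h i hi.2, ?_⟩
      split_ifs with hn
      · simpa using h n hn
      · trivial
    · rintro ⟨h1, h2⟩ i hi
      by_cases hin : i = n
      · subst hin; simpa [hi] using h2
      · simpa [Function.update_of_ne hin] using h1 i ⟨hin, hi⟩
  rw [hpre, Measure.prod_prod, sampleLaw, Measure.infinitePi_pi _ fun i _ => ht i]
  split_ifs with hn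
  · rw [Finset.prod_erase_mul _ _ hn]
  · rw [Finset.erase_eq_of_notMem hn]; simp

/-- Fubini's theorem for the noise of one stage. -/
theorem integral_sampleLaw_update (n : ℕ) {F : Sample → ℝ} (hF : Integrable F sampleLaw) :
    ∫ ω, F ω ∂sampleLaw = ∫ ω, ∫ w, F (Function.update ω n w) ∂noiseLaw ∂sampleLaw := by
  have h := measurePreserving_update n
  have hi := h.integrable_comp_of_integrable hF
  refine Eq.trans ?_ (integral_prod _ hi)
  conv_lhs => rw [← h.map_eq]
  exact integral_map h.measurable.aemeasurable (by rw [h.map_eq]; exact hF.aestronglyMeasurable)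

theorem integrable_integral_update (n : ℕ) {F : Sample → ℝ} (hF : Integrable F sampleLaw) :
    Integrable (fun ω => ∫ w, F (Function.update ω n w) ∂noiseLaw) sampleLaw :=
  ((measurePreserving_update n).integrable_comp_of_integrable hF).integral_prod_left

/-! ### Exponential moments of the Gaussian noise -/

theorem integrable_exp_mul_abs_gaussianReal (c : ℝ) :
    Integrable (fun x => Real.exp (c * |x|)) (gaussianReal 0 1) := by
  refine ((integrable_exp_mul_gaussianReal c).add (integrable_exp_mul_gaussianReal (-c))).mono'
    (by fun_prop) (.of_forall fun x => ?_)
  rw [Real.norm_of_nonneg (Real.exp_pos _).le]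
  rcases abs_cases x with ⟨h, _⟩ | ⟨h, _⟩ <;> rw [h]
  · exact le_add_of_nonneg_right (Real.exp_pos _).le
  · rw [mul_neg, ← neg_mul]; exact le_add_of_nonneg_left (Real.exp_pos _).le

/-- From `uv ≤ u² + v²`. It trades integrability of a product for that of each factor with doubled
exponent, so that no independence has to be invoked. -/
theorem exp_add_le (a b : ℝ) : Real.exp (a + b) ≤ Real.exp (2 * a) + Real.exp (2 * b) := by
  rw [Real.exp_add, two_mul, two_mul, Real.exp_add, Real.exp_add]
  nlinarith [sq_nonneg (Real.exp a - Real.exp b), sq_nonneg (Real.exp a), sq_nonneg (Real.exp b)]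

theorem integrable_exp_noise (c d : ℝ) :
    Integrable (fun w : Noise => Real.exp (c * (|w.1| + |w.2.1|) + d)) noiseLaw := by
  have h1 : Integrable (fun w : Noise => Real.exp (2 * c * |w.1|)) noiseLaw :=
    (measurePreserving_fst (μ := gaussianReal 0 1)).integrable_comp_of_integrable
      (integrable_exp_mul_abs_gaussianReal (2 * c))
  have h2 : Integrable (fun w : Noise => Real.exp (2 * c * |w.2.1|)) noiseLaw :=
    ((measurePreserving_fst (μ := gaussianReal 0 1)).comp
      measurePreserving_snd).integrable_comp_of_integrable
      (integrable_exp_mul_abs_gaussianReal (2 * c))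
  refine ((h1.add h2).mul_const (Real.exp d)).mono' (by fun_prop) (.of_forall fun w => ?_)
  rw [Real.norm_of_nonneg (Real.exp_pos _).le, Real.exp_add]
  refine mul_le_mul_of_nonneg_right ?_ (Real.exp_pos d).le
  simpa [mul_add, mul_assoc] using exp_add_le (c * |w.1|) (c * |w.2.1|)

/-! ### The mediator's draw -/

theorem sum_profile (f : Profile → ℝ) :
    ∑ a, f a = f ![false, false] + f ![false, true] + f ![true, false] + f ![true, true] := by
  rw [← (finTwoArrowEquiv Bool).symm.sum_comp, Fintype.sum_prod_type]
  simp [finTwoArrowEquiv]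
  ring

theorem integral_ite_le {c : ℝ} (h0 : 0 ≤ c) (h1 : c ≤ 1) :
    Integrable (fun e : unitInterval => if (e : ℝ) ≤ c then (1 : ℝ) else 0) ∧
      ∫ e : unitInterval, (if (e : ℝ) ≤ c then (1 : ℝ) else 0) = c := by
  have h : (fun e : unitInterval => if (e : ℝ) ≤ c then (1 : ℝ) else 0) =
      (Set.Iic (⟨c, h0, h1⟩ : unitInterval)).indicator 1 := by
    ext e
    simp [Set.indicator_apply, ← Subtype.coe_le_coe]
  rw [h]
  refine ⟨(integrable_const (1 : ℝ)).indicator measurableSet_Iic, ?_⟩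
  rw [integral_indicator_one measurableSet_Iic, Measure.real, unitInterval.volume_Iic,
    ENNReal.toReal_ofReal h0]

/-- The mediator's draw has the prescribed law. -/
theorem integral_draw {q : Profile → ℝ} (hq : q ∈ stdSimplex ℝ Profile) (f : Profile → ℝ) :
    ∫ e : unitInterval, f (draw q e) = ∑ a, q a * f a := by
  have hs := hq.2
  rw [sum_profile] at hs
  have h00 := hq.1 ![false, false]
  have h01 := hq.1 ![false, true]
  have h10 := hq.1 ![true, false]
  have h11 := hq.1 ![true, true]
  obtain ⟨i1, e1⟩ := integral_ite_le (c := q ![false, false]) h00 (by linarith)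
  obtain ⟨i2, e2⟩ := integral_ite_le (c := q ![false, false] + q ![false, true])
    (by linarith) (by linarith)
  obtain ⟨i3, e3⟩ := integral_ite_le (c := q ![false, false] + q ![false, true] + q ![true, false])
    (by linarith) (by linarith)
  -- Abel summation: the draw is a step function of `e`, written through indicators of three nested
  -- intervals starting at 0. Their lengths are the partial sums of `q`, and the last weight is
  -- recovered from total mass one.
  have key : ∀ e : unitInterval, f (draw q e) = f ![true, true]
      + (f ![true, false] - f ![true, true]) *
        (if (e : ℝ) ≤ q ![false, false] + q ![false, true] + q ![true, false] then 1 else 0)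
      + (f ![false, true] - f ![true, false]) *
        (if (e : ℝ) ≤ q ![false, false] + q ![false, true] then 1 else 0)
      + (f ![false, false] - f ![false, true]) *
        (if (e : ℝ) ≤ q ![false, false] then 1 else 0) := by
    intro e
    unfold draw
    split_ifs <;> first | (exfalso; linarith) | ring
  simp_rw [key]
  rw [integral_add (by fun_prop) (by fun_prop), integral_add (by fun_prop) (by fun_prop),
    integral_add (by fun_prop) (by fun_prop), integral_const_mul, integral_const_mul,
    integral_const_mul, e1, e2, e3, sum_profile]
  simp only [integral_const, probReal_univ, smul_eq_mul, one_mul]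
  linear_combination (- f ![true, true]) * hs

theorem measurable_draw :
    Measurable fun z : (Profile → ℝ) × ℝ => draw z.1 z.2 := by
  unfold draw
  refine Measurable.ite (measurableSet_le (by fun_prop) (by fun_prop)) measurable_const <|
    Measurable.ite (measurableSet_le (by fun_prop) (by fun_prop)) measurable_const <|
    Measurable.ite (measurableSet_le (by fun_prop) (by fun_prop)) measurable_const
      measurable_const

/-- The integral of a function of the prices and of a regime that depends only on the mediator's
draw and on the private randomization. -/
theorem integral_noiseLaw_regime {ψ : Profile → Noise → ℝ}
    (hψ : ∀ c, Integrable (ψ c) noiseLaw)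
    (hdep : ∀ c w w', w.1 = w'.1 → w.2.1 = w'.2.1 → ψ c w = ψ c w')
    {C : unitInterval → unitInterval → Profile} (hC : Measurable (Function.uncurry C)) :
    ∫ w : Noise, ψ (C w.2.2.1 w.2.2.2) w ∂noiseLaw =
      ∫ e', ∫ e, (∫ w, ψ (C e e') w ∂noiseLaw) := by
  let ν : Measure (unitInterval × unitInterval) := volume.prod volume
  let μ : Measure (ℝ × ℝ) := (gaussianReal 0 1).prod (gaussianReal 0 1)
  have hassoc : MeasurePreserving (MeasurableEquiv.prodAssoc : (ℝ × ℝ) × _ ≃ᵐ Noise)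
      (μ.prod ν) noiseLaw := measurePreserving_prodAssoc _ _ _
  have hint : ∀ f : Noise → ℝ, ∫ w, f w ∂noiseLaw
      = ∫ z, f (z.1.1, z.1.2, z.2) ∂(μ.prod ν) := fun f =>
    (hassoc.integral_comp' f).symm
  -- The two zeros are arbitrary: by `hdep`, `ψ c` ignores the uniform coordinates.
  let φ : Profile → ℝ × ℝ → ℝ := fun c y => ψ c (y.1, y.2, 0, 0)
  have hφ : ∀ c (z : (ℝ × ℝ) × unitInterval × unitInterval),
      ψ c (z.1.1, z.1.2, z.2) = φ c z.1 := fun c z => hdep _ _ _ rfl rfl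
  have hφi : ∀ c, Integrable (φ c) μ := by
    intro c
    have h1 : Integrable (fun z : (ℝ × ℝ) × unitInterval × unitInterval => φ c z.1) (μ.prod ν) := by
      have := hassoc.integrable_comp_of_integrable (hψ c)
      refine this.congr (.of_forall fun z => ?_)
      exact hφ c z
    have h2 := h1.integral_prod_left
    simpa using h2
  have hψφ : ∀ c, ∫ w, ψ c w ∂noiseLaw = ∫ y, φ c y ∂μ := by
    intro c
    rw [hint]
    simp_rw [hφ]
    rw [integral_fun_fst]
    simp
  have hind : ∀ c, Measurable fun z : unitInterval × unitInterval =>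
      if C z.1 z.2 = c then (1 : ℝ) else 0 := fun c =>
    Measurable.ite (hC (measurableSet_singleton c)) measurable_const measurable_const
  have hindi : ∀ c, Integrable (fun z : unitInterval × unitInterval =>
      if C z.1 z.2 = c then (1 : ℝ) else 0) ν := fun c =>
    (integrable_const (1 : ℝ)).mono' (hind c).aestronglyMeasurable
      (.of_forall fun z => by split_ifs <;> simp)
  -- Splitting over the finitely many regimes turns the integrand into a sum of products of a
  -- function of the price noise and an indicator in the uniform variables, which are independent.
  have hsplit : ∀ (z : unitInterval × unitInterval) (f : Profile → ℝ),
      f (C z.1 z.2) = ∑ c, f c * (if C z.1 z.2 = c then (1 : ℝ) else 0) := by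
    intro z f; simp
  have hlhs : ∫ w : Noise, ψ (C w.2.2.1 w.2.2.2) w ∂noiseLaw =
      ∑ c, (∫ y, φ c y ∂μ) * ∫ z, (if C z.1 z.2 = c then (1 : ℝ) else 0) ∂ν := by
    rw [hint]
    simp only [hφ]
    have : ∀ z : (ℝ × ℝ) × unitInterval × unitInterval, φ (C z.2.1 z.2.2) z.1 =
        ∑ c, φ c z.1 * (if C z.2.1 z.2.2 = c then (1 : ℝ) else 0) := fun z =>
      hsplit z.2 fun c => φ c z.1
    simp_rw [this]
    rw [integral_finsetSum _ fun c _ => (hφi c).mul_prod (hindi c)]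
    exact Finset.sum_congr rfl fun c _ => integral_prod_mul (φ c)
      fun z : unitInterval × unitInterval => if C z.1 z.2 = c then (1 : ℝ) else 0
  have hrhs : Integrable (fun z : unitInterval × unitInterval => ∫ w, ψ (C z.1 z.2) w ∂noiseLaw)
      ν := by
    simp_rw [hsplit _ fun c => ∫ w, ψ c w ∂noiseLaw]
    exact integrable_finsetSum _ fun c _ => (hindi c).const_mul _
  -- The private randomization `e'` is kept outside, so that deviations can later be treated as
  -- deterministic reactions to the signal.
  have hswap : ∫ e', ∫ e, (∫ w, ψ (C e e') w ∂noiseLaw) =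
      ∫ z, (∫ w, ψ (C z.1 z.2) w ∂noiseLaw) ∂ν := (integral_prod_symm _ hrhs).symm
  rw [hlhs, hswap]
  simp_rw [hsplit _ fun c => ∫ w, ψ c w ∂noiseLaw]
  rw [integral_finsetSum _ fun c _ => (hindi c).const_mul _]
  refine Finset.sum_congr rfl fun c _ => ?_
  rw [integral_const_mul, hψφ]

namespace Model

/-! ### Measurability of the model data -/

theorem measurable_profit (M : Model) (i : Fin 2) :
    Measurable fun y : ℝ × ℝ => M.profit i y.1 y.2 := by
  unfold profit; fun_prop

theorem measurable_nextP (M : Model) : Measurable fun z : ℝ × Noise => M.nextP z.1 z.2 :=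
  M.measurable_G.comp (measurable_fst.prodMk measurable_snd.fst)

theorem measurable_nextX (M : Model) :
    Measurable fun z : ℝ × Profile × Noise => M.nextX z.1 z.2.1 z.2.2 := by
  have h : Measurable fun z : ℝ × Profile × Noise => M.logLevel z.2.1 :=
    (measurable_of_countable M.logLevel).comp (measurable_fst.comp measurable_snd)
  unfold nextX
  fun_prop

theorem measurable_next (M : Model) :
    Measurable fun z : State × Profile × Noise => M.next z.1 z.2.1 z.2.2 := by
  have hX : Measurable fun z : State × Profile × Noise => M.nextX z.1.2.1 z.2.1 z.2.2 :=
    M.measurable_nextX.comp (g := fun v : ℝ × Profile × Noise => M.nextX v.1 v.2.1 v.2.2)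
      (f := fun z : State × Profile × Noise => (z.1.2.1, z.2.1, z.2.2)) (by fun_prop)
  have hP : Measurable fun z : State × Profile × Noise => M.nextP z.1.1 z.2.2 :=
    M.measurable_nextP.comp (g := fun v : ℝ × Noise => M.nextP v.1 v.2)
      (f := fun z : State × Profile × Noise => (z.1.1, z.2.2)) (by fun_prop)
  have hN : Measurable fun z : State × Profile × Noise =>
      fun i => z.1.2.2.2 i + if z.2.1 i = z.1.2.2.1 i then 0 else 1 :=
    (measurable_of_countable fun v : (Profile × (Fin 2 → ℕ)) × Profile =>
      fun i => v.1.2 i + if v.2 i = v.1.1 i then 0 else 1).comp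
      (f := fun z : State × Profile × Noise => (z.1.2.2, z.2.1)) (by fun_prop)
  exact hP.prodMk (hX.prodMk (measurable_snd.fst.prodMk hN))

theorem measurable_reward (M : Model) (i : Fin 2) :
    Measurable fun z : State × Profile => M.reward i z.1 z.2 := by
  have hp : Measurable fun z : State × Profile => M.profit i z.1.1 z.1.2.1 :=
    (M.measurable_profit i).comp (g := fun y : ℝ × ℝ => M.profit i y.1 y.2)
      (f := fun z : State × Profile => (z.1.1, z.1.2.1)) (by fun_prop)
  have hK : Measurable fun z : State × Profile => M.K i (z.1.2.2.1 i) (z.2 i) :=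
    (measurable_of_countable fun v : Profile × Profile => M.K i (v.1 i) (v.2 i)).comp
      (f := fun z : State × Profile => (z.1.2.2.1, z.2)) (by fun_prop)
  have hz : Measurable fun z : State × Profile => z.2 i :=
    (measurable_pi_apply i).comp measurable_snd
  have hs : MeasurableSet {z : State × Profile | z.2 i = true} :=
    hz (measurableSet_singleton true)
  exact (Measurable.ite hs (hp.mul_const _) measurable_const).sub hK

/-! ### Growth in the allowance price -/

theorem nextP_nonneg (M : Model) {p : ℝ} (hp : 0 ≤ p) (w : Noise) : 0 ≤ M.nextP p w :=
  M.G_nonneg _ _ hp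

theorem nextX_pos (M : Model) {x : ℝ} (hx : 0 < x) (c : Profile) (w : Noise) :
    0 < M.nextX x c w :=
  mul_pos hx (Real.exp_pos _)

/-- The log price follows an affine recursion with slope `1 - κX * dt`. No sign or size condition on
the slope is needed over a finite horizon; the sum over regimes makes `B` uniform in `c`. -/
theorem abs_log_nextX_le (M : Model) : ∃ A B S : ℝ, 0 ≤ A ∧ ∀ x c w, 0 < x →
    |Real.log (M.nextX x c w)| ≤ A * |Real.log x| + (S * (|w.1| + |w.2.1|) + B) := by
  refine ⟨|1 - M.κX * M.dt|, ∑ c, |M.κX * M.logLevel c * M.dt|, |M.σX|, abs_nonneg _,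
    fun x c w hx => ?_⟩
  have h1 : Real.log (M.nextX x c w) = (1 - M.κX * M.dt) * Real.log x +
      (M.σX * (M.ρ * w.1 + Real.sqrt (1 - M.ρ ^ 2) * w.2.1) + M.κX * M.logLevel c * M.dt) := by
    rw [nextX, Real.log_mul hx.ne' (Real.exp_pos _).ne', Real.log_exp]; ring
  have h2 : |M.κX * M.logLevel c * M.dt| ≤ ∑ c, |M.κX * M.logLevel c * M.dt| :=
    Finset.single_le_sum (f := fun c => |M.κX * M.logLevel c * M.dt|)
      (fun _ _ => abs_nonneg _) (Finset.mem_univ c)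
  have h3 : |M.ρ * w.1 + Real.sqrt (1 - M.ρ ^ 2) * w.2.1| ≤ |w.1| + |w.2.1| := by
    refine (abs_add_le _ _).trans (add_le_add ?_ ?_) <;> rw [abs_mul]
    · exact mul_le_of_le_one_left (abs_nonneg _) M.abs_ρ_le
    · refine mul_le_of_le_one_left (abs_nonneg _) ?_
      rw [abs_of_nonneg (Real.sqrt_nonneg _)]
      exact Real.sqrt_le_one.2 (by nlinarith [sq_nonneg M.ρ])
  rw [h1]
  refine (abs_add_le _ _).trans (add_le_add (abs_mul _ _).le ((abs_add_le _ _).trans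
    (add_le_add ?_ h2)))
  rw [abs_mul]
  exact mul_le_mul_of_nonneg_left h3 (abs_nonneg _)

/-- Growth at most exponential in `|log x|`, uniformly in `p ≥ 0`. -/
def HasLogGrowth (W : ℝ → ℝ → ℝ) : Prop :=
  ∃ C R : ℝ, 0 ≤ C ∧ 0 ≤ R ∧ ∀ p x, 0 ≤ p → 0 < x → |W p x| ≤ C * Real.exp (R * |Real.log x|)

theorem HasLogGrowth.const (c : ℝ) : HasLogGrowth fun _ _ => c :=
  ⟨|c|, 0, abs_nonneg _, le_rfl, fun _ _ _ _ => by simp⟩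

theorem HasLogGrowth.add {W W' : ℝ → ℝ → ℝ} (h : HasLogGrowth W) (h' : HasLogGrowth W') :
    HasLogGrowth fun p x => W p x + W' p x := by
  obtain ⟨C, R, hC, hR, h⟩ := h
  obtain ⟨C', R', hC', hR', h'⟩ := h'
  refine ⟨C + C', R + R', add_nonneg hC hC', add_nonneg hR hR', fun p x hp hx => ?_⟩
  have hl := abs_nonneg (Real.log x)
  rw [add_mul]
  refine (abs_add_le _ _).trans (add_le_add ((h p x hp hx).trans ?_) ((h' p x hp hx).trans ?_))
  · exact mul_le_mul_of_nonneg_left (Real.exp_le_exp.2 (by nlinarith)) hC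
  · exact mul_le_mul_of_nonneg_left (Real.exp_le_exp.2 (by nlinarith)) hC'

theorem HasLogGrowth.of_le {W W' : ℝ → ℝ → ℝ} (h : HasLogGrowth W)
    (hle : ∀ p x, 0 ≤ p → 0 < x → |W' p x| ≤ |W p x|) : HasLogGrowth W' := by
  obtain ⟨C, R, hC, hR, h⟩ := h
  exact ⟨C, R, hC, hR, fun p x hp hx => (hle p x hp hx).trans (h p x hp hx)⟩

theorem HasLogGrowth.abs {W : ℝ → ℝ → ℝ} (h : HasLogGrowth W) :
    HasLogGrowth fun p x => |W p x| :=
  h.of_le fun _ _ _ _ => (abs_abs _).le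

theorem HasLogGrowth.mul_const {W : ℝ → ℝ → ℝ} (h : HasLogGrowth W) (c : ℝ) :
    HasLogGrowth fun p x => W p x * c := by
  obtain ⟨C, R, hC, hR, h⟩ := h
  refine ⟨C * |c|, R, by positivity, hR, fun p x hp hx => ?_⟩
  rw [abs_mul, mul_right_comm]
  exact mul_le_mul_of_nonneg_right (h p x hp hx) (abs_nonneg c)

theorem HasLogGrowth.sum {ι : Type*} (s : Finset ι) {W : ι → ℝ → ℝ → ℝ}
    (h : ∀ j ∈ s, HasLogGrowth (W j)) : HasLogGrowth fun p x => ∑ j ∈ s, W j p x := by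
  classical
  induction s using Finset.induction_on with
  | empty => simpa using HasLogGrowth.const 0
  | insert j s hj ih =>
    simp_rw [Finset.sum_insert hj]
    exact (h j (by simp)).add (ih fun k hk => h k (by simp [hk]))

/-- A bound on the exponential moments of the next allowance price. -/
theorem exp_abs_log_nextX_le (M : Model) : ∃ A B S : ℝ, 0 ≤ A ∧ ∀ R x c w, 0 ≤ R → 0 < x →
    Real.exp (R * |Real.log (M.nextX x c w)|) ≤
      Real.exp (R * A * |Real.log x|) * Real.exp (R * S * (|w.1| + |w.2.1|) + R * B) := by
  obtain ⟨A, B, S, hA, h⟩ := M.abs_log_nextX_le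
  refine ⟨A, B, S, hA, fun R x c w hR hx => ?_⟩
  rw [← Real.exp_add]
  exact Real.exp_le_exp.2 ((mul_le_mul_of_nonneg_left (h x c w hx) hR).trans_eq (by ring))

theorem HasLogGrowth.integrable_next {W : ℝ → ℝ → ℝ} (h : HasLogGrowth W)
    (hm : Measurable (Function.uncurry W)) (M : Model) {p x : ℝ} (hp : 0 ≤ p) (hx : 0 < x)
    (c : Profile) :
    Integrable (fun w => W (M.nextP p w) (M.nextX x c w)) noiseLaw := by
  obtain ⟨C, R, hC, hR, h⟩ := h
  obtain ⟨A, B, S, hA, hb⟩ := M.exp_abs_log_nextX_le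
  refine (((integrable_exp_noise (R * S) (R * B)).const_mul
    (Real.exp (R * A * |Real.log x|))).const_mul C).mono' ?_ (.of_forall fun w => ?_)
  · refine (hm.comp (Measurable.prodMk ?_ ?_)).aestronglyMeasurable
    · exact M.measurable_nextP.comp (measurable_const.prodMk measurable_id)
    · exact M.measurable_nextX.comp (measurable_const.prodMk (measurable_const.prodMk measurable_id))
  · exact (h _ _ (M.nextP_nonneg hp w) (M.nextX_pos hx c w)).trans
      (mul_le_mul_of_nonneg_left (hb R x c w hR hx) hC)

/-- The rate `R` is multiplied by the autoregression bound `A`, and the noise contributes only a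
finite constant. This is what carries the growth bound through backward induction. -/
theorem HasLogGrowth.integral_next {W : ℝ → ℝ → ℝ} (h : HasLogGrowth W)
    (hm : Measurable (Function.uncurry W)) (M : Model) (c : Profile) :
    HasLogGrowth fun p x => ∫ w, W (M.nextP p w) (M.nextX x c w) ∂noiseLaw := by
  have h0 := h
  obtain ⟨C, R, hC, hR, h⟩ := h
  obtain ⟨A, B, S, hA, hb⟩ := M.exp_abs_log_nextX_le
  refine ⟨C * ∫ w, Real.exp (R * S * (|w.1| + |w.2.1|) + R * B) ∂noiseLaw, R * A,
    mul_nonneg hC (integral_nonneg fun _ => (Real.exp_pos _).le), mul_nonneg hR hA,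
    fun p x hp hx => ?_⟩
  calc |∫ w, W (M.nextP p w) (M.nextX x c w) ∂noiseLaw|
      ≤ ∫ w, |W (M.nextP p w) (M.nextX x c w)| ∂noiseLaw := abs_integral_le_integral_abs
    _ ≤ ∫ w, C * (Real.exp (R * A * |Real.log x|) *
          Real.exp (R * S * (|w.1| + |w.2.1|) + R * B)) ∂noiseLaw := by
        refine integral_mono (h0.integrable_next hm M hp hx c).abs
          (((integrable_exp_noise (R * S) (R * B)).const_mul _).const_mul C) fun w => ?_
        exact (h _ _ (M.nextP_nonneg hp w) (M.nextX_pos hx c w)).trans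
          (mul_le_mul_of_nonneg_left (hb R x c w hR hx) hC)
    _ = _ := by rw [integral_const_mul, integral_const_mul]; ring

/-- Above, the cap bounds the profit whatever `p` is; below, `a * p ≥ 0` can be dropped, and `x ≤
exp |log x|` controls the allowance cost. -/
theorem hasLogGrowth_profit (M : Model) (i : Fin 2) : HasLogGrowth (M.profit i) := by
  refine ⟨M.b i + |M.c i| + |M.cap|, 1, ?_, zero_le_one, fun p x hp hx => ?_⟩
  · have := M.b_nonneg i; positivity
  have hb := M.b_nonneg i
  have hap := mul_nonneg (M.a_nonneg i) hp
  have hE : 1 ≤ Real.exp (1 * |Real.log x|) := Real.one_le_exp (by positivity)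
  have hxE : x ≤ Real.exp (1 * |Real.log x|) := by
    rw [one_mul]
    calc x = Real.exp (Real.log x) := (Real.exp_log hx).symm
      _ ≤ _ := Real.exp_le_exp.2 (le_abs_self _)
  set E := Real.exp (1 * |Real.log x|)
  have h1 : M.b i * x ≤ M.b i * E := mul_le_mul_of_nonneg_left hxE hb
  have h2 : |M.c i| ≤ |M.c i| * E := le_mul_of_one_le_right (abs_nonneg _) hE
  have h3 : |M.cap| ≤ |M.cap| * E := le_mul_of_one_le_right (abs_nonneg _) hE
  have h4 : 0 ≤ M.b i * x := mul_nonneg hb hx.le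
  have h5 := abs_nonneg (M.c i)
  have h6 := abs_nonneg M.cap
  rw [add_mul, add_mul, abs_le, profit]
  refine ⟨le_min ?_ ?_, (min_le_right _ _).trans ?_⟩
  · linarith [le_abs_self (M.c i)]
  · linarith [neg_abs_le M.cap]
  · linarith [le_abs_self M.cap]

/-! ### The values found by backward induction -/

theorem measurable_continuation (M : Model) {W : Fin 2 → ℝ → ℝ → Profile → ℝ}
    (hW : ∀ i ξ, Measurable fun y : ℝ × ℝ => W i y.1 y.2 ξ) (i : Fin 2) (ξ : Profile) :
    Measurable fun y : ℝ × ℝ => M.continuation W i y.1 y.2 ξ := by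
  unfold continuation
  refine Measurable.add ?_ ?_
  · refine (StronglyMeasurable.integral_prod_right (ν := noiseLaw)
      (f := fun (y : ℝ × ℝ) w => W i (M.nextP y.1 w) (M.nextX y.2 ξ w) ξ) ?_).measurable
    refine ((hW i ξ).comp (Measurable.prodMk ?_ ?_)).stronglyMeasurable
    · exact M.measurable_nextP.comp (measurable_fst.fst.prodMk measurable_snd)
    · exact M.measurable_nextX.comp
        (measurable_fst.snd.prodMk (measurable_const.prodMk measurable_snd))
  · split_ifs
    · exact (M.measurable_profit i).mul_const _
    · exact measurable_const

theorem measurable_stageGame (M : Model) {W : Fin 2 → ℝ → ℝ → Profile → ℝ}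
    (hW : ∀ i ξ, Measurable fun y : ℝ × ℝ => W i y.1 y.2 ξ) (ζ : Profile) :
    Measurable fun y : ℝ × ℝ => M.stageGame (fun _ => W) y.1 y.2 ζ :=
  measurable_pi_lambda _ fun i => measurable_pi_lambda _ fun _ =>
    (M.measurable_continuation hW i _).sub_const _

theorem measurable_sel_stageGame (M : Model) (Γ : CorrelationLaw)
    {W : Fin 2 → ℝ → ℝ → Profile → ℝ}
    (hW : ∀ i ξ, Measurable fun y : ℝ × ℝ => W i y.1 y.2 ξ) (t : ℕ) (ζ : Profile) :
    Measurable fun y : ℝ × ℝ => Γ.sel t y.1 y.2 ζ (M.stageGame (fun _ => W) y.1 y.2 ζ) :=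
  (Γ.measurable_sel t ζ).comp
    (measurable_fst.prodMk (measurable_snd.prodMk (M.measurable_stageGame hW ζ)))

theorem measurable_backward (M : Model) (Γ : CorrelationLaw) (k : ℕ) (i : Fin 2) (ζ : Profile) :
    Measurable fun y : ℝ × ℝ => M.backward Γ k i y.1 y.2 ζ := by
  induction k generalizing i ζ with
  | zero => exact measurable_const
  | succ k ih =>
    have h1 := M.measurable_sel_stageGame Γ ih (M.T - (k + 1)) ζ
    have h2 := M.measurable_stageGame ih ζ
    refine Finset.measurable_sum _ fun a _ => Measurable.mul ?_ ?_
    · exact (measurable_pi_apply a).comp h1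
    · exact (measurable_pi_apply a).comp ((measurable_pi_apply i).comp h2)

theorem hasLogGrowth_stageGame (M : Model) {W : Fin 2 → ℝ → ℝ → Profile → ℝ}
    (hW : ∀ i ξ, Measurable fun y : ℝ × ℝ => W i y.1 y.2 ξ)
    (hg : ∀ i ξ, HasLogGrowth fun p x => W i p x ξ) (i : Fin 2) (ζ a : Profile) :
    HasLogGrowth fun p x => M.stageGame (fun _ => W) p x ζ i a := by
  unfold stageGame continuation
  simp_rw [sub_eq_add_neg]
  refine (((hg i _).integral_next (hW i _) M _).add ?_).add (.const _)
  split_ifs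
  · exact (M.hasLogGrowth_profit i).mul_const _
  · exact .const 0

theorem hasLogGrowth_backward (M : Model) (Γ : CorrelationLaw) (k : ℕ) (i : Fin 2)
    (ζ : Profile) : HasLogGrowth fun p x => M.backward Γ k i p x ζ := by
  induction k generalizing i ζ with
  | zero => exact .const 0
  | succ k ih =>
    refine (HasLogGrowth.sum Finset.univ fun a _ =>
      (M.hasLogGrowth_stageGame (M.measurable_backward Γ k) ih i ζ a).abs).of_le
      -- The value is a convex combination of stage payoffs, so the sum of their absolute values
      -- dominates it whatever the correlation law selects.
      fun p x _ _ => ?_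
    refine le_trans ?_ (le_abs_self _)
    refine (Finset.abs_sum_le_sum_abs _ _).trans (Finset.sum_le_sum fun a _ => ?_)
    have hq := (Γ.isCE_sel (M.T - (k + 1)) p x ζ
      (M.stageGame (fun _ => M.backward Γ k) p x ζ)).1
    rw [abs_mul, abs_of_nonneg (hq.1 a)]
    refine mul_le_of_le_one_left (abs_nonneg _) ?_
    exact (Finset.single_le_sum (fun b _ => hq.1 b) (Finset.mem_univ a)).trans_eq hq.2

/-! ### One stage of play -/

/-- Exclusive or with `ζ` is an involution, so the same map translates moves into regimes and
regimes into moves. -/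
theorem applyMove_applyMove (ζ c : Profile) : applyMove ζ (applyMove ζ c) = c := by
  funext i; simp [applyMove]

theorem applyMove_update (ζ a : Profile) (i : Fin 2) (b : Bool) :
    applyMove ζ (Function.update a i b) = Function.update (applyMove ζ a) i (xor (ζ i) b) := by
  funext j
  by_cases h : j = i
  · subst h; simp [applyMove]
  · simp [applyMove, Function.update_of_ne h]

section Stage

variable {M : Model} {W : Fin 2 → ℝ → ℝ → Profile → ℝ}
  (hW : ∀ i ξ, Measurable fun y : ℝ × ℝ => W i y.1 y.2 ξ)
  (hg : ∀ i ξ, HasLogGrowth fun p x => W i p x ξ)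

include hW hg

theorem integrable_stage (i : Fin 2) {S : State} (hp : 0 ≤ S.1) (hx : 0 < S.2.1) (c : Profile) :
    Integrable (fun w => M.reward i S c + W i (M.nextP S.1 w) (M.nextX S.2.1 c w) c)
      noiseLaw :=
  (integrable_const _).add ((hg i c).integrable_next (hW i c) M hp hx c)

theorem integral_stage (i : Fin 2) {S : State} (hp : 0 ≤ S.1) (hx : 0 < S.2.1) (c : Profile) :
    ∫ w, (M.reward i S c + W i (M.nextP S.1 w) (M.nextX S.2.1 c w) c) ∂noiseLaw =
      M.stageGame (fun _ => W) S.1 S.2.1 S.2.2.1 i (applyMove S.2.2.1 c) := by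
  rw [integral_add (integrable_const _) ((hg i c).integrable_next (hW i c) M hp hx c)]
  simp only [integral_const, probReal_univ, one_smul, stageGame, continuation, reward,
    applyMove_applyMove]
  ring

theorem integrable_stage_regime (i : Fin 2) {S : State} (hp : 0 ≤ S.1) (hx : 0 < S.2.1)
    {C : Noise → Profile} (hC : Measurable C) :
    Integrable (fun w => M.reward i S (C w) + W i (M.nextP S.1 w) (M.nextX S.2.1 (C w) w) (C w))
      noiseLaw := by
  have h : ∀ w, M.reward i S (C w) + W i (M.nextP S.1 w) (M.nextX S.2.1 (C w) w) (C w) =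
      ∑ c, {w | C w = c}.indicator
        (fun w => M.reward i S c + W i (M.nextP S.1 w) (M.nextX S.2.1 c w) c) w := by
    intro w
    simp [Set.indicator_apply]
  simp_rw [h]
  exact integrable_finsetSum _ fun c _ =>
    (integrable_stage hW hg i hp hx c).indicator (hC (measurableSet_singleton c))

theorem integral_stage_regime (i : Fin 2) {S : State} (hp : 0 ≤ S.1) (hx : 0 < S.2.1)
    {C : unitInterval → unitInterval → Profile} (hC : Measurable (Function.uncurry C)) :
    ∫ w : Noise, (M.reward i S (C w.2.2.1 w.2.2.2) +
        W i (M.nextP S.1 w) (M.nextX S.2.1 (C w.2.2.1 w.2.2.2) w) (C w.2.2.1 w.2.2.2)) ∂noiseLaw =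
      ∫ e', ∫ e, M.stageGame (fun _ => W) S.1 S.2.1 S.2.2.1 i (applyMove S.2.2.1 (C e e')) := by
  rw [integral_noiseLaw_regime
    (ψ := fun c w => M.reward i S c + W i (M.nextP S.1 w) (M.nextX S.2.1 c w) c)
    (integrable_stage hW hg i hp hx) ?_ hC]
  · simp_rw [integral_stage hW hg i hp hx]
  · intro c w w' h1 h2
    simp only [nextP, nextX, h1, h2]

/-- The expected value of a stage in which both players obey. -/
theorem integral_stage_obey (i : Fin 2) {S : State} (hp : 0 ≤ S.1) (hx : 0 < S.2.1)
    {q : Profile → ℝ} (hq : q ∈ stdSimplex ℝ Profile) {C : Noise → Profile}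
    (hC : ∀ w, C w = applyMove S.2.2.1 (draw q w.2.2.1)) :
    ∫ w, (M.reward i S (C w) + W i (M.nextP S.1 w) (M.nextX S.2.1 (C w) w) (C w)) ∂noiseLaw =
      ∑ a, q a * M.stageGame (fun _ => W) S.1 S.2.1 S.2.2.1 i a := by
  simp_rw [hC]
  have hm : Measurable (Function.uncurry fun (e _e' : unitInterval) =>
      applyMove S.2.2.1 (draw q e)) :=
    (measurable_of_countable (applyMove S.2.2.1)).comp
      (measurable_draw.comp (measurable_const.prodMk (measurable_subtype_coe.comp measurable_fst)))
  rw [integral_stage_regime hW hg i hp hx hm]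
  simp_rw [applyMove_applyMove]
  rw [integral_draw hq]
  simp

/-- The expected value of a stage in which player `i` reacts arbitrarily to her signal and her
private randomization. -/
theorem integral_stage_deviate_le (i : Fin 2) {S : State} (hp : 0 ≤ S.1) (hx : 0 < S.2.1)
    {q : Profile → ℝ} (hq : IsOneShotCE (M.stageGame (fun _ => W) S.1 S.2.1 S.2.2.1) q)
    {v : unitInterval → unitInterval → Bool} (hv : Measurable (Function.uncurry v))
    (hdep : ∀ e₁ e₂ e' : unitInterval, draw q e₁ i = draw q e₂ i → v e₁ e' = v e₂ e')
    {C : Noise → Profile}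
    (hC : ∀ w, C w =
      Function.update (applyMove S.2.2.1 (draw q w.2.2.1)) i (v w.2.2.1 w.2.2.2)) :
    ∫ w, (M.reward i S (C w) + W i (M.nextP S.1 w) (M.nextX S.2.1 (C w) w) (C w)) ∂noiseLaw ≤
      ∑ a, q a * M.stageGame (fun _ => W) S.1 S.2.1 S.2.2.1 i a := by
  simp_rw [hC]
  set H := M.stageGame (fun _ => W) S.1 S.2.1 S.2.2.1 with hH
  have hm : Measurable (Function.uncurry fun (e e' : unitInterval) =>
      Function.update (applyMove S.2.2.1 (draw q e)) i (v e e')) :=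
    (measurable_of_countable fun z : Profile × Bool =>
      Function.update (applyMove S.2.2.1 z.1) i z.2).comp
      (f := fun z : unitInterval × unitInterval => (draw q z.1, v z.1 z.2))
      ((measurable_draw.comp
        (measurable_const.prodMk (measurable_subtype_coe.comp measurable_fst))).prodMk hv)
  rw [integral_stage_regime hW hg i hp hx hm, ← hH]
  have hle : ∀ e', ∫ e : unitInterval, H i (applyMove S.2.2.1
      (Function.update (applyMove S.2.2.1 (draw q e)) i (v e e'))) ≤ ∑ a, q a * H i a := by
    intro e'
    -- With `e'` frozen, the deviation becomes a function `h` of the recommendation only.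
    obtain ⟨h, hh⟩ := (Function.factorsThrough_iff (f := fun e : unitInterval => draw q e i)
      fun e => v e e').1 fun e₁ e₂ he => hdep e₁ e₂ e' he
    have hh' : ∀ e, v e e' = h (draw q e i) := fun e => congrFun hh e
    simp_rw [hh', applyMove_update, applyMove_applyMove]
    -- Grouping joint moves by the recommendation `j`, the deviating move `xor (ζ i) (h j)` is
    -- constant on each group, so one equilibrium inequality applies per group.
    rw [integral_draw hq.1 fun a => H i (Function.update a i (xor (S.2.2.1 i) (h (a i)))),
      ← Finset.sum_fiberwise (s := Finset.univ) (g := fun a : Profile => a i),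
      ← Finset.sum_fiberwise (s := Finset.univ) (g := fun a : Profile => a i)
        (f := fun a => q a * H i a)]
    refine Finset.sum_le_sum fun j _ => ?_
    refine le_trans (le_of_eq ?_) (hq.2 i j (xor (S.2.2.1 i) (h j)))
    refine Finset.sum_congr rfl fun a ha => ?_
    rw [(Finset.mem_filter.1 ha).2]
  have hmeas : Measurable (Function.uncurry fun (e e' : unitInterval) => H i (applyMove S.2.2.1
      (Function.update (applyMove S.2.2.1 (draw q e)) i (v e e')))) :=
    (measurable_of_countable fun c : Profile => H i (applyMove S.2.2.1 c)).comp hm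
  have hint : Integrable (fun e' => ∫ e : unitInterval, H i (applyMove S.2.2.1
      (Function.update (applyMove S.2.2.1 (draw q e)) i (v e e')))) := by
    have h0 : Integrable (Function.uncurry fun (e e' : unitInterval) => H i (applyMove S.2.2.1
        (Function.update (applyMove S.2.2.1 (draw q e)) i (v e e'))))
        ((volume : Measure unitInterval).prod volume) :=
      (integrable_const (∑ a, |H i a|)).mono' hmeas.aestronglyMeasurable
        (.of_forall fun z => Finset.single_le_sum (f := fun a => |H i a|)
          (fun _ _ => abs_nonneg _) (Finset.mem_univ _))
    exact h0.integral_prod_right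
  exact (integral_mono hint (integrable_const _) hle).trans_eq (by simp)

end Stage

/-! ### The state process -/

theorem path_nonneg (M : Model) (δ : Device) (R : Rule) (s : ℕ) {S₀ : State} (hp : 0 ≤ S₀.1)
    (ω : Sample) (k : ℕ) : 0 ≤ (M.path δ R s S₀ ω k).1 := by
  induction k with
  | zero => exact hp
  | succ k ih => exact M.nextP_nonneg ih _

theorem path_pos (M : Model) (δ : Device) (R : Rule) (s : ℕ) {S₀ : State} (hx : 0 < S₀.2.1)
    (ω : Sample) (k : ℕ) : 0 < (M.path δ R s S₀ ω k).2.1 := by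
  induction k with
  | zero => exact hx
  | succ k ih => exact M.nextX_pos ih _ _

theorem path_succ (M : Model) (δ : Device) (R : Rule) (s : ℕ) (S₀ : State) (ω : Sample) (k : ℕ) :
    M.path δ R s S₀ ω (k + 1) =
      M.next (M.path δ R s S₀ ω k) (M.control δ R s S₀ ω k) (ω (s + k)) :=
  rfl

/-- The regimes chosen in the play are measurable and do not anticipate the noise. -/
structure IsNonanticipating (M : Model) (δ : Device) (R : Rule) (s : ℕ) (S₀ : State) : Prop where
  measurable_control : ∀ k < M.T - s, Measurable fun ω => M.control δ R s S₀ ω k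
  control_congr : ∀ k < M.T - s, ∀ ω ω' : Sample, (∀ j ≤ k, ω (s + j) = ω' (s + j)) →
    M.control δ R s S₀ ω k = M.control δ R s S₀ ω' k

theorem measurable_path {M : Model} {δ : Device} {R : Rule} {s : ℕ} {S₀ : State} (k : ℕ)
    (h : ∀ j < k, Measurable fun ω => M.control δ R s S₀ ω j) :
    Measurable fun ω => M.path δ R s S₀ ω k := by
  induction k with
  | zero => exact measurable_const
  | succ k ih =>
    exact M.measurable_next.comp ((ih fun j hj => h j (hj.trans k.lt_succ_self)).prodMk
      ((h k k.lt_succ_self).prodMk (measurable_pi_apply (s + k))))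

theorem path_congr {M : Model} {δ : Device} {R : Rule} {s : ℕ} {S₀ : State} {ω ω' : Sample}
    (k : ℕ) (h : ∀ j < k, ω (s + j) = ω' (s + j))
    (hc : ∀ j < k, M.control δ R s S₀ ω j = M.control δ R s S₀ ω' j) :
    M.path δ R s S₀ ω k = M.path δ R s S₀ ω' k := by
  induction k with
  | zero => rfl
  | succ k ih =>
    rw [path_succ, path_succ, h k k.lt_succ_self, hc k k.lt_succ_self,
      ih (fun j hj => h j (hj.trans k.lt_succ_self)) fun j hj => hc j (hj.trans k.lt_succ_self)]

/-- Induction on the stage with the rate `r` left free: one step back costs the rate `2 * r * A`,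
the factor 2 coming from `exp_add_le`. -/
theorem integrable_exp_log_path {M : Model} {δ : Device} {R : Rule} {s : ℕ} {S₀ : State}
    (hx : 0 < S₀.2.1) (k : ℕ) (h : ∀ j < k, Measurable fun ω => M.control δ R s S₀ ω j)
    {r : ℝ} (hr : 0 ≤ r) :
    Integrable (fun ω => Real.exp (r * |Real.log (M.path δ R s S₀ ω k).2.1|)) sampleLaw := by
  obtain ⟨A, B, S, hA, hb⟩ := M.exp_abs_log_nextX_le
  induction k generalizing r with
  | zero => exact integrable_const (Real.exp (r * |Real.log S₀.2.1|))
  | succ k ih =>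
    have h1 := ih (fun j hj => h j (hj.trans k.lt_succ_self)) (r := 2 * (r * A)) (by positivity)
    have h2 : Integrable (fun ω : Sample => Real.exp
        (2 * (r * S) * (|(ω (s + k)).1| + |(ω (s + k)).2.1|) + 2 * (r * B))) sampleLaw :=
      (measurePreserving_eval_infinitePi (fun _ : ℕ => noiseLaw)
        (s + k)).integrable_comp_of_integrable (integrable_exp_noise _ _)
    have hm : Measurable fun ω => (M.path δ R s S₀ ω (k + 1)).2.1 :=
      (measurable_path (k + 1) h).snd.fst
    refine (h1.add h2).mono' ?_ (.of_forall fun ω => ?_)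
    · exact (Real.measurable_exp.comp ((Real.measurable_log.comp hm).abs.const_mul
        r)).aestronglyMeasurable
    · rw [Real.norm_of_nonneg (Real.exp_pos _).le]
      refine (hb r _ _ _ hr (M.path_pos δ R s hx ω k)).trans ?_
      rw [← Real.exp_add]
      refine (exp_add_le _ _).trans_eq ?_
      simp only [Pi.add_apply, mul_add, mul_assoc]

theorem HasLogGrowth.integrable_path {W : ℝ → ℝ → ℝ} (hW : HasLogGrowth W) {M : Model}
    {δ : Device} {R : Rule} {s : ℕ} {S₀ : State} (hp : 0 ≤ S₀.1) (hx : 0 < S₀.2.1) (k : ℕ)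
    (h : ∀ j < k, Measurable fun ω => M.control δ R s S₀ ω j) {F : Sample → ℝ}
    (hF : Measurable F)
    (hle : ∀ ω, |F ω| ≤ W (M.path δ R s S₀ ω k).1 (M.path δ R s S₀ ω k).2.1) :
    Integrable F sampleLaw := by
  obtain ⟨C, r, hC, hr, hb⟩ := hW
  refine ((integrable_exp_log_path hx k h hr).const_mul C).mono' hF.aestronglyMeasurable
    (.of_forall fun ω => (hle ω).trans ((le_abs_self _).trans ?_))
  exact hb _ _ (M.path_nonneg δ R s hp ω k) (M.path_pos δ R s hx ω k)

theorem integrable_reward {M : Model} {δ : Device} {R : Rule} {s : ℕ} {S₀ : State}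
    (hR : M.IsNonanticipating δ R s S₀) (hp : 0 ≤ S₀.1) (hx : 0 < S₀.2.1) (i : Fin 2) {k : ℕ}
    (hk : k < M.T - s) :
    Integrable (fun ω => M.reward i (M.path δ R s S₀ ω k) (M.control δ R s S₀ ω k))
      sampleLaw := by
  have hc : ∀ j < k, Measurable fun ω => M.control δ R s S₀ ω j := fun j hj =>
    hR.measurable_control j (hj.trans hk)
  refine (((M.hasLogGrowth_profit i).mul_const M.dt).abs.add
    (.const (∑ z : Bool × Bool, |M.K i z.1 z.2|))).integrable_path hp hx k hc ?_ fun ω => ?_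
  · exact (M.measurable_reward i).comp ((measurable_path k hc).prodMk (hR.measurable_control k hk))
  · refine (abs_sub _ _).trans (add_le_add ?_ ?_)
    · split_ifs
      · rfl
      · rw [abs_zero]; exact abs_nonneg _
    · exact Finset.single_le_sum (f := fun z : Bool × Bool => |M.K i z.1 z.2|)
        (fun _ _ => abs_nonneg _) (Finset.mem_univ (_, _))

theorem measurable_value_state (M : Model) (Γ : CorrelationLaw) (k : ℕ) (i : Fin 2) :
    Measurable fun S : State => M.backward Γ k i S.1 S.2.1 S.2.2.1 := by
  have h : Measurable fun z : (ℝ × ℝ) × Profile => M.backward Γ k i z.1.1 z.1.2 z.2 :=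
    measurable_from_prod_countable_left fun ζ => M.measurable_backward Γ k i ζ
  exact h.comp (f := fun S : State => ((S.1, S.2.1), S.2.2.1)) (by fun_prop)

theorem integrable_value_path {M : Model} (Γ : CorrelationLaw) {δ : Device} {R : Rule} {s : ℕ}
    {S₀ : State} (hR : M.IsNonanticipating δ R s S₀) (hp : 0 ≤ S₀.1) (hx : 0 < S₀.2.1)
    (i : Fin 2) (n : ℕ) {k : ℕ} (hk : k ≤ M.T - s) :
    Integrable (fun ω => M.backward Γ n i (M.path δ R s S₀ ω k).1 (M.path δ R s S₀ ω k).2.1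
      (M.path δ R s S₀ ω k).2.2.1) sampleLaw := by
  have hc : ∀ j < k, Measurable fun ω => M.control δ R s S₀ ω j := fun j hj =>
    hR.measurable_control j (hj.trans_le hk)
  refine (HasLogGrowth.sum Finset.univ fun ζ _ =>
    (M.hasLogGrowth_backward Γ n i ζ).abs).integrable_path hp hx k hc
    ((M.measurable_value_state Γ n i).comp (measurable_path k hc)) fun ω => ?_
  exact Finset.single_le_sum
    (f := fun ζ => |M.backward Γ n i (M.path δ R s S₀ ω k).1 (M.path δ R s S₀ ω k).2.1 ζ|)
    (fun _ _ => abs_nonneg _) (Finset.mem_univ _)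

/-! ### Dynamic programming -/

/-- Profits collected over the first `k` stages plus the value at the state then reached. -/
def runningValue (M : Model) (Γ : CorrelationLaw) (i : Fin 2) (δ : Device) (R : Rule) (s : ℕ)
    (S₀ : State) (k : ℕ) (ω : Sample) : ℝ :=
  ∑ j ∈ Finset.range k, M.reward i (M.path δ R s S₀ ω j) (M.control δ R s S₀ ω j) +
    M.backward Γ (M.T - (s + k)) i (M.path δ R s S₀ ω k).1 (M.path δ R s S₀ ω k).2.1
      (M.path δ R s S₀ ω k).2.2.1

section Dynamic

variable {M : Model} {Γ : CorrelationLaw} {δ : Device} {R : Rule} {s : ℕ} {S₀ : State}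
  (hR : M.IsNonanticipating δ R s S₀) (hp : 0 ≤ S₀.1) (hx : 0 < S₀.2.1)

include hR

theorem IsNonanticipating.control_update {j k : ℕ} (hj : j < k) (hk : k ≤ M.T - s) (ω : Sample)
    (w : Noise) : M.control δ R s S₀ (Function.update ω (s + k) w) j =
      M.control δ R s S₀ ω j :=
  hR.control_congr j (hj.trans_le hk) _ _ fun l hl => Function.update_of_ne (by omega) _ _

theorem IsNonanticipating.path_update {j k : ℕ} (hj : j ≤ k) (hk : k ≤ M.T - s) (ω : Sample)
    (w : Noise) : M.path δ R s S₀ (Function.update ω (s + k) w) j = M.path δ R s S₀ ω j :=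
  path_congr j (fun _ hl => Function.update_of_ne (by omega) _ _) fun _ hl =>
    hR.control_update (hl.trans_le hj) hk ω w

include hp hx

theorem integrable_runningValue (i : Fin 2) {k : ℕ} (hk : k ≤ M.T - s) :
    Integrable (M.runningValue Γ i δ R s S₀ k) sampleLaw :=
  (integrable_finsetSum _ fun _ hj =>
    integrable_reward hR hp hx i ((Finset.mem_range.1 hj).trans_le hk)).add
    (integrable_value_path Γ hR hp hx i _ hk)

theorem integrable_payoff (i : Fin 2) : Integrable (M.payoff i δ R s S₀) sampleLaw :=
  integrable_finsetSum _ fun _ hj => integrable_reward hR hp hx i (Finset.mem_range.1 hj)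

/-- Non-anticipation freezes the first `k` rewards and the state at stage `s + k`, so that
resampling leaves a one-stage problem at a fixed state. -/
theorem integral_runningValue_update (i : Fin 2) {k : ℕ} (hk : k < M.T - s) (ω : Sample) :
    ∫ w, M.runningValue Γ i δ R s S₀ (k + 1) (Function.update ω (s + k) w) ∂noiseLaw =
      ∑ j ∈ Finset.range k, M.reward i (M.path δ R s S₀ ω j) (M.control δ R s S₀ ω j) +
      ∫ w, (M.reward i (M.path δ R s S₀ ω k)
          (M.control δ R s S₀ (Function.update ω (s + k) w) k) +
        M.backward Γ (M.T - (s + k + 1)) i (M.nextP (M.path δ R s S₀ ω k).1 w)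
          (M.nextX (M.path δ R s S₀ ω k).2.1
            (M.control δ R s S₀ (Function.update ω (s + k) w) k) w)
          (M.control δ R s S₀ (Function.update ω (s + k) w) k)) ∂noiseLaw := by
  have h : ∀ w, M.runningValue Γ i δ R s S₀ (k + 1) (Function.update ω (s + k) w) =
      ∑ j ∈ Finset.range k, M.reward i (M.path δ R s S₀ ω j) (M.control δ R s S₀ ω j) +
      (M.reward i (M.path δ R s S₀ ω k)
          (M.control δ R s S₀ (Function.update ω (s + k) w) k) +
        M.backward Γ (M.T - (s + k + 1)) i (M.nextP (M.path δ R s S₀ ω k).1 w)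
          (M.nextX (M.path δ R s S₀ ω k).2.1
            (M.control δ R s S₀ (Function.update ω (s + k) w) k) w)
          (M.control δ R s S₀ (Function.update ω (s + k) w) k)) := by
    intro w
    rw [runningValue, Finset.sum_range_succ, path_succ, hR.path_update le_rfl hk.le,
      Function.update_self, add_assoc]
    congr 1
    refine Finset.sum_congr rfl fun j hj => ?_
    have hj' := Finset.mem_range.1 hj
    rw [hR.path_update hj'.le hk.le, hR.control_update hj' hk.le]
  simp_rw [h]
  have hup : Measurable fun w : Noise => Function.update ω (s + k) w := measurable_update ω
  have hi := integrable_stage_regime (M := M)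
    (fun i ξ => M.measurable_backward Γ (M.T - (s + k + 1)) i ξ)
    (fun i ξ => M.hasLogGrowth_backward Γ (M.T - (s + k + 1)) i ξ) i
    (M.path_nonneg δ R s hp ω k) (M.path_pos δ R s hx ω k)
    ((hR.measurable_control k hk).comp hup)
  refine (integral_add (integrable_const _) hi).trans ?_
  simp

/-- If no stage improves on the value function, then neither does the whole play. -/
theorem integral_payoff_le (i : Fin 2) (hsT : s ≤ M.T)
    (h : ∀ k < M.T - s, ∀ ω,
      ∫ w, (M.reward i (M.path δ R s S₀ ω k)
          (M.control δ R s S₀ (Function.update ω (s + k) w) k) +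
        M.backward Γ (M.T - (s + k + 1)) i (M.nextP (M.path δ R s S₀ ω k).1 w)
          (M.nextX (M.path δ R s S₀ ω k).2.1
            (M.control δ R s S₀ (Function.update ω (s + k) w) k) w)
          (M.control δ R s S₀ (Function.update ω (s + k) w) k)) ∂noiseLaw ≤
      M.backward Γ (M.T - (s + k)) i (M.path δ R s S₀ ω k).1 (M.path δ R s S₀ ω k).2.1
        (M.path δ R s S₀ ω k).2.2.1) :
    ∫ ω, M.payoff i δ R s S₀ ω ∂sampleLaw ≤
      M.backward Γ (M.T - s) i S₀.1 S₀.2.1 S₀.2.2.1 := by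
  have key : ∀ k ≤ M.T - s, ∫ ω, M.runningValue Γ i δ R s S₀ k ω ∂sampleLaw ≤
      M.backward Γ (M.T - s) i S₀.1 S₀.2.1 S₀.2.2.1 := by
    intro k
    induction k with
    | zero => intro _; simp [runningValue, path]
    | succ k ih =>
      intro hk
      have hi := integrable_runningValue (Γ := Γ) hR hp hx i hk
      refine le_trans ?_ (ih (k.le_succ.trans hk))
      rw [integral_sampleLaw_update (s + k) hi]
      refine integral_mono (integrable_integral_update (s + k) hi)
        (integrable_runningValue hR hp hx i (k.le_succ.trans hk)) fun ω => ?_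
      beta_reduce
      rw [integral_runningValue_update hR hp hx i hk, runningValue]
      exact add_le_add le_rfl (h k hk ω)
  -- At the horizon no stages remain, so the value term is `backward` at 0, which vanishes, and the
  -- running value is the payoff.
  have := key (M.T - s) le_rfl
  simpa [runningValue, payoff, Nat.add_sub_cancel' hsT, backward] using this

theorem integral_payoff_eq (i : Fin 2) (hsT : s ≤ M.T)
    (h : ∀ k < M.T - s, ∀ ω,
      ∫ w, (M.reward i (M.path δ R s S₀ ω k)
          (M.control δ R s S₀ (Function.update ω (s + k) w) k) +
        M.backward Γ (M.T - (s + k + 1)) i (M.nextP (M.path δ R s S₀ ω k).1 w)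
          (M.nextX (M.path δ R s S₀ ω k).2.1
            (M.control δ R s S₀ (Function.update ω (s + k) w) k) w)
          (M.control δ R s S₀ (Function.update ω (s + k) w) k)) ∂noiseLaw =
      M.backward Γ (M.T - (s + k)) i (M.path δ R s S₀ ω k).1 (M.path δ R s S₀ ω k).2.1
        (M.path δ R s S₀ ω k).2.2.1) :
    ∫ ω, M.payoff i δ R s S₀ ω ∂sampleLaw =
      M.backward Γ (M.T - s) i S₀.1 S₀.2.1 S₀.2.2.1 := by
  have key : ∀ k ≤ M.T - s, ∫ ω, M.runningValue Γ i δ R s S₀ k ω ∂sampleLaw =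
      M.backward Γ (M.T - s) i S₀.1 S₀.2.1 S₀.2.2.1 := by
    intro k
    induction k with
    | zero => intro _; simp [runningValue, path]
    | succ k ih =>
      intro hk
      rw [← ih (k.le_succ.trans hk),
        integral_sampleLaw_update (s + k) (integrable_runningValue hR hp hx i hk)]
      refine integral_congr_ae (.of_forall fun ω => ?_)
      beta_reduce
      rw [integral_runningValue_update hR hp hx i hk, runningValue, h k hk ω]
  have := key (M.T - s) le_rfl
  simpa [runningValue, payoff, Nat.add_sub_cancel' hsT, backward] using this

end Dynamic

/-! ### Obedience and admissible deviations do not anticipate the noise -/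

theorem measurable_recommendation {M : Model} {δ : Device} (hδ : ∀ t, Measurable (δ t)) {R : Rule}
    {s : ℕ} {S₀ : State} {k : ℕ} (h : Measurable fun ω => M.path δ R s S₀ ω k) :
    Measurable fun ω => M.recommendation δ R s S₀ ω k :=
  measurable_draw.comp (((hδ (s + k)).comp h).prodMk
    (measurable_subtype_coe.comp (measurable_pi_apply (s + k)).snd.snd.fst))

theorem recommendation_congr {M : Model} {δ : Device} {R : Rule} {s : ℕ} {S₀ : State}
    {ω ω' : Sample} {k : ℕ} (h : M.path δ R s S₀ ω k = M.path δ R s S₀ ω' k)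
    (hω : ω (s + k) = ω' (s + k)) :
    M.recommendation δ R s S₀ ω k = M.recommendation δ R s S₀ ω' k := by
  rw [recommendation, recommendation, h, hω]

/-- Strong induction: the state at stage `k` uses only earlier controls and noises, and the current
control adds only the current draw. -/
theorem isNonanticipating_obey (M : Model) {δ : Device} (hδ : ∀ t, Measurable (δ t)) (s : ℕ)
    (S₀ : State) : M.IsNonanticipating δ obey s S₀ where
  measurable_control k _ := by
    induction k using Nat.strong_induction_on with
    | _ k ih =>
      have hpath := measurable_path k fun j hj => ih j hj (by omega)
      exact (measurable_of_countable fun z : Profile × Profile => applyMove z.1 z.2).comp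
        (hpath.snd.snd.fst.prodMk (measurable_recommendation hδ hpath))
  control_congr k _ ω ω' h := by
    induction k using Nat.strong_induction_on with
    | _ k ih =>
      have hpath : M.path δ obey s S₀ ω k = M.path δ obey s S₀ ω' k :=
        path_congr k (fun j hj => h j hj.le) fun j hj =>
          ih j hj (by omega) fun l hl => h l (hl.trans hj.le)
      rw [control, control, obey, obey, recommendation_congr hpath (h k le_rfl), hpath]

/-- An admissible schedule is a function of the information of the player. -/
theorem IsAdmissible.congr {M : Model} {δ : Device} {i : Fin 2} {s : ℕ} {S₀ : State}
    {u : ℕ → Sample → Bool} (hu : M.IsAdmissible δ i s S₀ u) {k : ℕ} (hk : k < M.T - s)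
    {ω ω' : Sample}
    (h : ∀ j ≤ k, M.path δ (deviate i u) s S₀ ω j = M.path δ (deviate i u) s S₀ ω' j ∧
      M.recommendation δ (deviate i u) s S₀ ω j i = M.recommendation δ (deviate i u) s S₀ ω' j i ∧
      (ω (s + j)).2.2.2 = (ω' (s + j)).2.2.2) :
    u (s + k) ω = u (s + k) ω' := by
  let f : Sample → Fin (k + 1) → State × Bool × unitInterval := fun ω j =>
    (M.path δ (deviate i u) s S₀ ω j, M.recommendation δ (deviate i u) s S₀ ω j i,
      (ω (s + j)).2.2.2)
  have hf : f ω = f ω' := by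
    funext j
    obtain ⟨h1, h2, h3⟩ := h j (Nat.lt_succ_iff.1 j.2)
    simp only [f, h1, h2, h3]
  -- The information σ-algebra lies in the one pulled back along the joint map `f`. Its sets are
  -- preimages under `f`, hence cannot separate samples with equal `f`.
  have hle : (⨆ j : Fin (k + 1), MeasurableSpace.comap (fun ω => f ω j) inferInstance) ≤
      MeasurableSpace.comap f inferInstance := by
    refine iSup_le fun j => ?_
    rintro _ ⟨B, hB, rfl⟩
    exact ⟨(fun g => g j) ⁻¹' B, measurable_pi_apply j hB, rfl⟩
  have hm : MeasurableSet[MeasurableSpace.comap f inferInstance] (u (s + k) ⁻¹' {u (s + k) ω}) :=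
    hle _ (hu k hk (measurableSet_singleton _))
  obtain ⟨B, -, hB⟩ := hm
  have h1 : ω ∈ f ⁻¹' B := by rw [hB]; rfl
  have h2 : ω' ∈ f ⁻¹' B := by
    rw [Set.mem_preimage, ← hf]; exact h1
  rw [hB] at h2
  exact h2.symm

theorem IsAdmissible.measurable {M : Model} {δ : Device} (hδ : ∀ t, Measurable (δ t)) {i : Fin 2}
    {s : ℕ} {S₀ : State} {u : ℕ → Sample → Bool} (hu : M.IsAdmissible δ i s S₀ u) {k : ℕ}
    (hk : k < M.T - s)
    (h : ∀ j ≤ k, Measurable fun ω => M.path δ (deviate i u) s S₀ ω j) :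
    Measurable (u (s + k)) := by
  refine (hu k hk).mono (iSup_le fun j => Measurable.comap_le ?_) le_rfl
  have hj := h j (Nat.lt_succ_iff.1 j.2)
  exact hj.prodMk (((measurable_pi_apply i).comp (measurable_recommendation hδ hj)).prodMk
    (measurable_pi_apply (s + (j : ℕ))).snd.snd.snd)

/-- The apparent circularity, admissibility of `u` referring to the play driven by `u`, is harmless:
the states up to stage `k` involve `u` only at earlier stages. -/
theorem IsAdmissible.isNonanticipating {M : Model} {δ : Device} (hδ : ∀ t, Measurable (δ t))
    {i : Fin 2} {s : ℕ} {S₀ : State} {u : ℕ → Sample → Bool} (hu : M.IsAdmissible δ i s S₀ u) :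
    M.IsNonanticipating δ (deviate i u) s S₀ where
  measurable_control k hk := by
    induction k using Nat.strong_induction_on with
    | _ k ih =>
      have hpath : ∀ j ≤ k, Measurable fun ω => M.path δ (deviate i u) s S₀ ω j := fun j hj =>
        measurable_path j fun l hl => ih l (hl.trans_le hj) (by omega)
      exact (measurable_of_countable fun z : Profile × Profile × Bool =>
        Function.update (applyMove z.1 z.2.1) i z.2.2).comp
        ((hpath k le_rfl).snd.snd.fst.prodMk
          ((measurable_recommendation hδ (hpath k le_rfl)).prodMk (hu.measurable hδ hk hpath)))
  control_congr k hk ω ω' h := by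
    induction k using Nat.strong_induction_on with
    | _ k ih =>
      have hpath : ∀ j ≤ k,
          M.path δ (deviate i u) s S₀ ω j = M.path δ (deviate i u) s S₀ ω' j := fun j hj =>
        path_congr j (fun l hl => h l (hl.le.trans hj)) fun l hl =>
          ih l (hl.trans_le hj) (by omega) fun m hm => h m (hm.trans (hl.le.trans hj))
      have hu' : u (s + k) ω = u (s + k) ω' := hu.congr hk fun j hj =>
        ⟨hpath j hj, congrFun (recommendation_congr (hpath j hj) (h j hj)) i, by rw [h j hj]⟩
      rw [control, control, deviate, deviate, hu',
        recommendation_congr (hpath k le_rfl) (h k le_rfl), hpath k le_rfl]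

/-! ### The device generated by a correlation law -/

theorem measurable_inducedDevice (M : Model) (Γ : CorrelationLaw) (t : ℕ) (ζ : Profile) :
    Measurable fun y : ℝ × ℝ => M.inducedDevice Γ t y.1 y.2 ζ :=
  M.measurable_sel_stageGame Γ (M.measurable_backward Γ _) t ζ

theorem measurable_toDevice {γ : MarkovDevice} {t : ℕ}
    (h : ∀ ζ, Measurable fun y : ℝ × ℝ => γ t y.1 y.2 ζ) : Measurable (γ.toDevice t) := by
  have h' : Measurable fun z : (ℝ × ℝ) × Profile => γ t z.1.1 z.1.2 z.2 :=
    measurable_from_prod_countable_left h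
  exact h'.comp (f := fun S : State => ((S.1, S.2.1), S.2.2.1)) (by fun_prop)

theorem measurable_inducedDevice_toDevice (M : Model) (Γ : CorrelationLaw) (t : ℕ) :
    Measurable ((M.inducedDevice Γ).toDevice t) :=
  measurable_toDevice (M.measurable_inducedDevice Γ t)

theorem backward_eq_sum (M : Model) (Γ : CorrelationLaw) {t : ℕ} (ht : t < M.T) (i : Fin 2)
    (p x : ℝ) (ζ : Profile) :
    M.backward Γ (M.T - t) i p x ζ = ∑ a, M.inducedDevice Γ t p x ζ a *
      M.stageGame (fun _ => M.backward Γ (M.T - (t + 1))) p x ζ i a := by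
  have h1 : M.T - t = M.T - (t + 1) + 1 := by omega
  have h2 : M.T - (M.T - (t + 1) + 1) = t := by omega
  rw [h1, backward, h2, inducedDevice]

/-- The game values of the induced device are those found by backward induction. -/
theorem gameValue_inducedDevice (M : Model) (Γ : CorrelationLaw) (i : Fin 2) {s : ℕ}
    (hs : s ≤ M.T) {p x : ℝ} (hp : 0 ≤ p) (hx : 0 < x) (ζ : Profile) :
    M.gameValue (M.inducedDevice Γ) i s p x ζ = M.backward Γ (M.T - s) i p x ζ := by
  have hR := M.isNonanticipating_obey (M.measurable_inducedDevice_toDevice Γ) s (start p x ζ)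
  refine integral_payoff_eq (Γ := Γ) hR hp hx i hs fun k hk ω => ?_
  rw [M.backward_eq_sum Γ (show s + k < M.T by omega)]
  refine integral_stage_obey (M := M) (fun i ξ => M.measurable_backward Γ _ i ξ)
    (fun i ξ => M.hasLogGrowth_backward Γ _ i ξ) i (M.path_nonneg _ _ s hp ω k)
    (M.path_pos _ _ s hx ω k) (Γ.isCE_sel _ _ _ _ _).1 fun w => ?_
  rw [control, obey, recommendation, hR.path_update le_rfl hk.le, Function.update_self]
  rfl

theorem expectedProfit_deviate_le (M : Model) (Γ : CorrelationLaw) (i : Fin 2) {s : ℕ}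
    (hs : s ≤ M.T) {p x : ℝ} (hp : 0 ≤ p) (hx : 0 < x) (ζ : Profile) {u : ℕ → Sample → Bool}
    (hu : M.IsAdmissible (M.inducedDevice Γ).toDevice i s (start p x ζ) u) :
    M.expectedProfit i (M.inducedDevice Γ).toDevice (deviate i u) s p x ζ ≤
      M.backward Γ (M.T - s) i p x ζ := by
  have hδ := M.measurable_inducedDevice_toDevice Γ
  have hR := hu.isNonanticipating hδ
  refine integral_payoff_le (Γ := Γ) hR hp hx i hs fun k hk ω => ?_
  rw [M.backward_eq_sum Γ (show s + k < M.T by omega)]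
  have hpath : ∀ j ≤ k, ∀ w, M.path (M.inducedDevice Γ).toDevice (deviate i u) s (start p x ζ)
      (Function.update ω (s + k) w) j =
      M.path (M.inducedDevice Γ).toDevice (deviate i u) s (start p x ζ) ω j := fun j hj w =>
    hR.path_update hj hk.le ω w
  -- The past being unaffected by resampling, the current noise reaches the schedule only through
  -- the player's own signal and her private randomization.
  have hucongr : ∀ w w' : Noise,
      signal (M.inducedDevice Γ).toDevice (s + k)
        (M.path (M.inducedDevice Γ).toDevice (deviate i u) s (start p x ζ) ω k) w i =
      signal (M.inducedDevice Γ).toDevice (s + k)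
        (M.path (M.inducedDevice Γ).toDevice (deviate i u) s (start p x ζ) ω k) w' i →
      w.2.2.2 = w'.2.2.2 →
      u (s + k) (Function.update ω (s + k) w) = u (s + k) (Function.update ω (s + k) w') := by
    intro w w' h1 h2
    refine hu.congr hk fun j hj => ⟨by rw [hpath j hj, hpath j hj], ?_, ?_⟩
    · rw [recommendation, recommendation, hpath j hj, hpath j hj]
      rcases hj.lt_or_eq with hj' | rfl
      · rw [Function.update_of_ne (by omega), Function.update_of_ne (by omega)]
      · simpa using h1
    · rcases hj.lt_or_eq with hj' | rfl
      · rw [Function.update_of_ne (by omega), Function.update_of_ne (by omega)]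
      · simpa using h2
  have hum : Measurable (u (s + k)) := hu.measurable hδ hk fun j hj =>
    measurable_path j fun l hl => hR.measurable_control l (by omega)
  refine integral_stage_deviate_le (M := M) (fun i ξ => M.measurable_backward Γ _ i ξ)
    (fun i ξ => M.hasLogGrowth_backward Γ _ i ξ) i (M.path_nonneg _ _ s hp ω k)
    (M.path_pos _ _ s hx ω k) (Γ.isCE_sel _ _ _ _ _)
    -- The price innovations of the current stage are not yet observed, so by `hucongr` they may be
    -- set to 0.
    (v := fun e e' => u (s + k) (Function.update ω (s + k) (0, 0, e, e'))) ?_ ?_ fun w => ?_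
  · exact hum.comp ((measurable_update ω).comp
      (f := fun z : unitInterval × unitInterval => ((0, 0, z.1, z.2) : Noise)) (by fun_prop))
  · intro e₁ e₂ e' h
    exact hucongr _ _ h rfl
  · rw [control, deviate, recommendation, hpath k le_rfl, Function.update_self,
      hucongr w (0, 0, w.2.2.1, w.2.2.2) rfl rfl]
    rfl

theorem isCorrelatedEquilibrium_inducedDevice (M : Model) (Γ : CorrelationLaw) :
    M.IsCorrelatedEquilibrium (M.inducedDevice Γ).toDevice := by
  intro s p x ζ hs hp hx i
  have hδ := M.measurable_inducedDevice_toDevice Γ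
  refine ⟨integrable_payoff (M.isNonanticipating_obey hδ s _) hp hx i, fun u hu =>
    ⟨integrable_payoff (hu.isNonanticipating hδ) hp hx i, ?_⟩⟩
  exact (M.expectedProfit_deviate_le Γ i hs hp hx ζ hu).trans_eq
    (M.gameValue_inducedDevice Γ i hs hp hx ζ).symm

theorem isMarkovCEP_inducedDevice (M : Model) (Γ : CorrelationLaw) :
    M.IsMarkovCEP (M.inducedDevice Γ) :=
  ⟨M.measurable_inducedDevice Γ, fun _ _ _ _ => (Γ.isCE_sel _ _ _ _ _).1,
    M.isCorrelatedEquilibrium_inducedDevice Γ⟩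

/-! ### Bounded numbers of switches -/

/-- A bound on the number of switches is void if it is at least the number of stages to go. -/
theorem budgetValue_eq_backward (M : Model) (Γ : CorrelationLaw) (k : ℕ) {n : Fin 2 → ℕ}
    (hn : ∀ i, k ≤ n i) : M.budgetValue Γ k n = M.backward Γ k := by
  induction k generalizing n with
  | zero => rfl
  | succ k ih =>
    have hspend : ∀ a, M.budgetValue Γ k (spend n a) = M.backward Γ k := fun a => ih fun i => by
      have := hn i
      unfold spend
      split_ifs <;> omega
    have h0 : n 0 ≠ 0 := by have := hn 0; omega
    have h1 : n 1 ≠ 0 := by have := hn 1; omega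
    funext i p x ζ
    simp only [budgetValue, backward, hspend, budgetWeights, if_neg h0, if_neg h1]

/-- With at most `t` switches made before date `t`, at least `T - t` are left, and at least `T - (t
+ 1)` after the next move, as many as the stages then to go. The condition on the counters excludes
unreachable states, where budgets could bind. -/
theorem budgetDevice_eq_inducedDevice (M : Model) (Γ : CorrelationLaw) {t : ℕ} (ht : t < M.T)
    {S : State} (hS : ∀ i, S.2.2.2 i ≤ t) :
    M.budgetDevice Γ (fun _ => M.T) t S = (M.inducedDevice Γ).toDevice t S := by
  have hspend : ∀ a, M.budgetValue Γ (M.T - (t + 1)) (spend (fun i => M.T - S.2.2.2 i) a) =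
      M.backward Γ (M.T - (t + 1)) := fun a => M.budgetValue_eq_backward Γ _ fun i => by
    have := hS i
    unfold spend
    beta_reduce
    split_ifs <;> omega
  have h0 : M.T - S.2.2.2 0 ≠ 0 := by have := hS 0; omega
  have h1 : M.T - S.2.2.2 1 ≠ 0 := by have := hS 1; omega
  simp only [budgetDevice, hspend, budgetWeights, if_neg h0, if_neg h1, MarkovDevice.toDevice,
    inducedDevice]

theorem switches_path_le (M : Model) (δ : Device) (R : Rule) (s : ℕ) (p x : ℝ) (ζ : Profile)
    (ω : Sample) (k : ℕ) (i : Fin 2) : (M.path δ R s (start p x ζ) ω k).2.2.2 i ≤ k := by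
  induction k with
  | zero => simp [path, start]
  | succ k ih =>
    refine add_le_add ih ?_
    split_ifs <;> simp

/-! ### Devices agreeing in all reachable states -/

section Transfer

variable {M : Model} {δ δ' : Device}
  (h : ∀ t < M.T, ∀ S : State, (∀ i, S.2.2.2 i ≤ t) → δ t S = δ' t S)

include h

theorem path_congr_device (R : Rule) {s : ℕ} (p x : ℝ) (ζ : Profile) (ω : Sample) {k : ℕ}
    (hk : k ≤ M.T - s) :
    M.path δ R s (start p x ζ) ω k = M.path δ' R s (start p x ζ) ω k := by
  induction k with
  | zero => rfl
  | succ k ih =>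
    have ih := ih (by omega)
    simp only [path, signal]
    rw [ih, h (s + k) (by omega) _ fun i =>
      (M.switches_path_le δ' R s p x ζ ω k i).trans (Nat.le_add_left k s)]

theorem recommendation_congr_device (R : Rule) {s : ℕ} (p x : ℝ) (ζ : Profile) (ω : Sample) {k : ℕ}
    (hk : k < M.T - s) :
    M.recommendation δ R s (start p x ζ) ω k = M.recommendation δ' R s (start p x ζ) ω k := by
  rw [recommendation, recommendation, signal, signal, path_congr_device h R p x ζ ω hk.le,
    h (s + k) (by omega) _ fun i =>
      (M.switches_path_le δ' R s p x ζ ω k i).trans (Nat.le_add_left k s)]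

theorem control_congr_device (R : Rule) {s : ℕ} (p x : ℝ) (ζ : Profile) (ω : Sample) {k : ℕ}
    (hk : k < M.T - s) :
    M.control δ R s (start p x ζ) ω k = M.control δ' R s (start p x ζ) ω k := by
  rw [control, control, recommendation_congr_device h R p x ζ ω hk,
    path_congr_device h R p x ζ ω hk.le]

theorem payoff_congr_device (i : Fin 2) (R : Rule) {s : ℕ} (p x : ℝ) (ζ : Profile) :
    M.payoff i δ R s (start p x ζ) = M.payoff i δ' R s (start p x ζ) := by
  funext ω
  refine Finset.sum_congr rfl fun k hk => ?_
  have hk := Finset.mem_range.1 hk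
  rw [control_congr_device h R p x ζ ω hk, path_congr_device h R p x ζ ω hk.le]

theorem expectedProfit_congr_device (i : Fin 2) (R : Rule) (s : ℕ) (p x : ℝ) (ζ : Profile) :
    M.expectedProfit i δ R s p x ζ = M.expectedProfit i δ' R s p x ζ := by
  rw [expectedProfit, expectedProfit, payoff_congr_device h]

/-- The two devices give the deviating player the same states and signals, hence the same
information σ-algebras. This is why the preceding lemmas allow any rule `R`. -/
theorem IsAdmissible.congr_device {i : Fin 2} {s : ℕ} {p x : ℝ} {ζ : Profile}
    {u : ℕ → Sample → Bool} (hu : M.IsAdmissible δ i s (start p x ζ) u) :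
    M.IsAdmissible δ' i s (start p x ζ) u := by
  intro k hk
  convert hu k hk using 1
  refine iSup_congr fun j => ?_
  have hj : (j : ℕ) < M.T - s := (Nat.lt_succ_iff.1 j.2).trans_lt hk
  congr 1
  funext ω
  rw [path_congr_device h _ p x ζ ω hj.le, recommendation_congr_device h _ p x ζ ω hj]

theorem IsCorrelatedEquilibrium.congr_device (hδ : M.IsCorrelatedEquilibrium δ') :
    M.IsCorrelatedEquilibrium δ := by
  intro s p x ζ hs hp hx i
  obtain ⟨h1, h2⟩ := hδ s p x ζ hs hp hx i
  refine ⟨by rwa [payoff_congr_device h], fun u hu => ?_⟩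
  rw [payoff_congr_device h, expectedProfit_congr_device h, expectedProfit_congr_device h]
  exact h2 u (hu.congr_device h)

end Transfer

end Model

end SwitchingGame

end

theorem mainTheorem1 (M : SwitchingGame.Model) (Γ : SwitchingGame.CorrelationLaw) :
    -- the device generated by `Γ` is a Markovian correlated equilibrium point
    M.IsMarkovCEP (M.inducedDevice Γ) ∧
    -- terminal condition and backward recursion for its game values
    (∀ (i : Fin 2) (p x : ℝ) (ζ : SwitchingGame.Profile),
      M.gameValue (M.inducedDevice Γ) i M.T p x ζ = 0) ∧
    (∀ (t : ℕ) (p x : ℝ) (ζ : SwitchingGame.Profile), t < M.T → 0 ≤ p → 0 < x →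
      let V : Fin 2 → ℕ → ℝ → ℝ → SwitchingGame.Profile → ℝ :=
        fun i => M.gameValue (M.inducedDevice Γ) i
      let Y : Fin 2 → SwitchingGame.Profile → ℝ := fun i ξ =>
        (∫ w, V i (t + 1) (M.nextP p w) (M.nextX x ξ w) ξ ∂SwitchingGame.noiseLaw)
          + (if ξ i then M.profit i p x * M.dt else 0)
      let γ : Bool → Bool → ℝ := fun j k => M.inducedDevice Γ t p x ζ ![j, k]
      -- the conditional expectations are integrals of integrable functions
      (∀ (i : Fin 2) (ξ : SwitchingGame.Profile),
        MeasureTheory.Integrable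
          (fun w => V i (t + 1) (M.nextP p w) (M.nextX x ξ w) ξ) SwitchingGame.noiseLaw) ∧
      -- the stage weights are selected by `Γ` from the stage game with these continuation values
      M.inducedDevice Γ t p x ζ =
        Γ.sel t p x ζ (fun i a =>
          Y i (SwitchingGame.applyMove ζ a)
            - M.K i (ζ i) (SwitchingGame.applyMove ζ a i)) ∧
      V 0 t p x ζ =
        γ false false * Y 0 ![ζ 0, ζ 1]
          + γ false true * Y 0 ![ζ 0, !ζ 1]
          + γ true false * (Y 0 ![!ζ 0, ζ 1] - M.K 0 (ζ 0) (!ζ 0))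
          + γ true true * (Y 0 ![!ζ 0, !ζ 1] - M.K 0 (ζ 0) (!ζ 0)) ∧
      V 1 t p x ζ =
        γ false false * Y 1 ![ζ 0, ζ 1]
          + γ false true * (Y 1 ![ζ 0, !ζ 1] - M.K 1 (ζ 1) (!ζ 1))
          + γ true false * Y 1 ![!ζ 0, ζ 1]
          + γ true true * (Y 1 ![!ζ 0, !ζ 1] - M.K 1 (ζ 1) (!ζ 1))) ∧
    -- the controls of the game with at most `T` switches for each player are equilibrium controls
    M.IsCorrelatedEquilibrium (M.budgetDevice Γ fun _ => M.T) ∧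
    (∀ (s : ℕ) (p x : ℝ) (ζ : SwitchingGame.Profile), s ≤ M.T → 0 ≤ p → 0 < x →
      (∀ (ω : SwitchingGame.Sample), ∀ k < M.T - s,
        M.control (M.budgetDevice Γ fun _ => M.T) SwitchingGame.Model.obey s
            (SwitchingGame.Model.start p x ζ) ω k =
          M.control (M.inducedDevice Γ).toDevice SwitchingGame.Model.obey s
            (SwitchingGame.Model.start p x ζ) ω k) ∧
      ∀ i : Fin 2,
        M.expectedProfit i (M.budgetDevice Γ fun _ => M.T) SwitchingGame.Model.obey s p x ζ =
          M.gameValue (M.inducedDevice Γ) i s p x ζ ∧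
        M.budgetValue Γ (M.T - s) (fun _ => M.T) i p x ζ =
          M.gameValue (M.inducedDevice Γ) i s p x ζ) := by
  have hdev : ∀ t < M.T, ∀ S : SwitchingGame.State, (∀ i, S.2.2.2 i ≤ t) →
      M.budgetDevice Γ (fun _ => M.T) t S = (M.inducedDevice Γ).toDevice t S :=
    fun t ht S hS => M.budgetDevice_eq_inducedDevice Γ ht hS
  refine ⟨M.isMarkovCEP_inducedDevice Γ, fun i p x ζ => ?_, ?_,
    (M.isCorrelatedEquilibrium_inducedDevice Γ).congr_device hdev,
    fun s p x ζ hs hp hx =>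
      ⟨fun ω k hk => SwitchingGame.Model.control_congr_device hdev _ p x ζ ω hk,
      fun i => ⟨SwitchingGame.Model.expectedProfit_congr_device hdev i _ s p x ζ, ?_⟩⟩⟩
  · simp [SwitchingGame.Model.gameValue, SwitchingGame.Model.expectedProfit,
      SwitchingGame.Model.payoff]
  · intro t p x ζ ht hp hx V Y γ
    -- Game values are identified with `backward` only for `p ≥ 0` and `x > 0`, a region that the
    -- price dynamics never leave.
    have hV : ∀ i ξ w, V i (t + 1) (M.nextP p w) (M.nextX x ξ w) ξ =
        M.backward Γ (M.T - (t + 1)) i (M.nextP p w) (M.nextX x ξ w) ξ := fun i ξ w =>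
      M.gameValue_inducedDevice Γ i ht (M.nextP_nonneg hp w) (M.nextX_pos hx ξ w) ξ
    have hY : ∀ i ξ, Y i ξ = M.continuation (M.backward Γ (M.T - (t + 1))) i p x ξ := by
      intro i ξ
      simp only [Y, hV, SwitchingGame.Model.continuation]
    have hsum : ∀ i, V i t p x ζ = ∑ a, M.inducedDevice Γ t p x ζ a *
        (Y i (SwitchingGame.applyMove ζ a) -
          M.K i (ζ i) (SwitchingGame.applyMove ζ a i)) := by
      intro i
      simp only [hY]
      exact (M.gameValue_inducedDevice Γ i ht.le hp hx ζ).trans (M.backward_eq_sum Γ ht i p x ζ)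
    have happ : ∀ j k, SwitchingGame.applyMove ζ ![j, k] = ![xor (ζ 0) j, xor (ζ 1) k] := by
      intro j k
      funext i
      fin_cases i <;> rfl
    refine ⟨fun i ξ => ?_, ?_, ?_, ?_⟩
    · simp_rw [hV]
      exact (M.hasLogGrowth_backward Γ _ i ξ).integrable_next (M.measurable_backward Γ _ i ξ) M
        hp hx ξ
    · simp_rw [hY]
      rfl
    · rw [hsum, SwitchingGame.sum_profile]
      simp [happ, γ, M.K_self]
    · rw [hsum, SwitchingGame.sum_profile]
      simp [happ, γ, M.K_self]
  · rw [M.budgetValue_eq_backward Γ (M.T - s) fun _ => Nat.sub_le _ _]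
    exact (M.gameValue_inducedDevice Γ i hs hp hx ζ).symm
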